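/- **Setting.** Let $\Omega\subset\mathbb R^2$ be a bounded Lipschitz domain (nonempty, open) with outward unit normal $n$, let $X=\{x_1,\dots,x_N\}\subset\overline\Omega$ be distinct nodes, $h=(|\Omega|/N)^{1/2}$, and let $K_i=\{y\in\Omega:\|y-x_i\|\le\|y-x_j\|\ \forall j\}$ be their Voronoi cells. Let $\Psi_1,\dots,\Psi_N$ be the cardinal functions of one of the following two methods, for a radial basis function $\phi$ with $\phi(\|\cdot\|)\in C^2(\mathbb R^2)$ and the monomials $p_1,\dots,p_m$ of degree at most $D_m$. * *Kansa's global method:* $\Psi_k(y)=[\,b(y)\tilde A^{-1}]_k$, $1\le k\le N$, where $b(y)=(\phi(\|y-x_1\|),\dots,\phi(\|y-x_N\|),p_1(y),\dots,p_m(y))$ and $\tilde A=\begin{pmatrix}A&P\\P^T&0\end{pmatrix}$, $A_{jl}=\phi(\|x_j-x_l\|)$, $P_{jk}=p_k(x_j)$, is invertible. * *RBF-PUM:* $\Psi_i=\sum_{j:\,x_i\in\Omega^{(j)}}w_j\psi^{(j)}_i$, where the open discs $\Omega^{(j)}$ with centres $\xi_j$ and radii $R_j>0$ cover $\overline\Omega$,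 $\psi^{(j)}_i$ are the cardinal functions as above for the nodes in $\Omega^{(j)}$ (with invertible local matrices), and $w_j=\Phi_j/\sum_i\Phi_i$, $\Phi_j(y)=(4r_j+1)(1-r_j)_+^4$, $r_j=\|y-\xi_j\|/R_j$. Let $F'(\cdot,t)$, $t\in[0,T]$, $T>0$, be velocity fields, each the restriction of a $C^1$ field on $\mathbb R^2$, with $\nabla\cdot F'=0$ in $\Omega$. Let $Y=\{y_1,\dots,y_M\}$ be the points in $\Omega$ of a Cartesian grid of mesh size $h_y\in(0,h]$ (arbitrary offset), and $\|u\|_{\ell_2}^2=h_y^2\sum_{k=1}^M u(y_k)^2$. Put $\bar E_{ki}=h_y\Psi_i(y_k)$, $\bar D_{ki}(t)=-h_y\,F'(y_k,t)\cdot\nabla\Psi_i(y_k)$, and let $u_h(y,t)=\sum_i u_i(t)\Psi_i(y)$, where the nodal values solve the least-squares projected system $\bar E^T\bar E\,\partial_t\underline u=\bar E^T\bar D(t)\,\underline u$ on $[0,T]$ (one-sided derivatives at the end points). Let $\Gamma_{\rm inflow}(t)=\{y\in\partial\Omega: F'\cdot n<0\}$. For a set $S$ of functions let $C_I(S)$ be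 the smallest $\kappa\ge0$ with $\|\nabla f\|_{L_\infty(K_i)}\le\kappa h^{-1}\|f\|_{L_\infty(K_i)}$ for all $f\in S$ and all $i$. Write $C_I$ for the constant of the trial space $\mathrm{span}\{\Psi_i\}$ and $C_{I,f}(t)$ for that of $\{u\,F'(\cdot,t)\cdot\nabla u:\ u\in\mathrm{span}\{\Psi_i\}\}$. **Theorem.** There is a constant $c>0$ depending only on $\Omega$ such that, for all the data above, $C_I$ and $C_{I,f}(t)$ exist (are finite), and with $C_{\int}=c\,(1+C_{I,f}(t))$ and $C=2\,C_{\int}C_I$, which do not depend on $Y$, $h_y$ or $u_h$, the function $t\mapsto\|u_h\|^2_{\ell_2}$ is differentiable on $[0,T]$ and for all $t\in[0,T]$ $$\begin{aligned}\partial_t\|u_h\|_{\ell_2}^2&\le 2C_{\int}\,h^{-1}h_y\max_i\|u_h\,(F'\cdot\nabla u_h)\|_{L_\infty(K_i)}+2\int_{\Gamma_{\rm inflow}}u_h^2\,|F'\cdot n|\,ds\\&\le C\,h^{-2}h_y\max_i\|F'\|_{L_\infty(K_i)}\|u_h\|^2_{L_\infty(K_i)}+2\int_{\Gamma_{\rm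 inflow}}u_h^2\,|F'\cdot n|\,ds.\end{aligned}$$ For fixed nodes and basis, $C_{\int}$ and $C$ are bounded uniformly over all spatially constant velocity fields. Moreover, for fixed nodes, basis and velocity field the spurious term vanishes as the oversampling grows: for every $t\in[0,T]$ and $\varepsilon>0$ there is $\delta>0$ such that for all $Y$ with $h_y<\delta$ and all $u_h$ as above, $$\partial_t\|u_h\|_{\ell_2}^2\le\varepsilon\max_i\|F'\|_{L_\infty(K_i)}\|u_h\|^2_{L_\infty(K_i)}+2\int_{\Gamma_{\rm inflow}}u_h^2\,|F'\cdot n|\,ds.$$ -/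

import Mathlib

open MeasureTheory Set Filter Topology
open scoped Matrix NNReal

noncomputable section

/-- The Euclidean plane, with the Euclidean norm. -/
abbrev Plane : Type := EuclideanSpace ℝ (Fin 2)

/-! ### The domain, its outward normal and the boundary integral -/

/-- A nonempty bounded open set which, near each boundary point and in suitable orthonormal
coordinates, is the region below the graph of a Lipschitz function. -/
structure IsLipschitzDomain (Ω : Set Plane) : Prop where
  isOpen : IsOpen Ω
  nonempty : Ω.Nonempty
  bounded : Bornology.IsBounded Ω
  boundary : ∀ p ∈ frontier Ω, ∃ (e : Plane ≃ₗᵢ[ℝ] Plane) (g : ℝ → ℝ) (K : ℝ≥0) (r : ℝ),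
    0 < r ∧ LipschitzWith K g ∧
      ∀ z ∈ Metric.ball p r, z ∈ Ω ↔ (e z) 1 < g ((e z) 0)

/-- `ν` is the outward unit normal of `Ω` at `x`: seen from `x`, the set `Ω` is asymptotically
the half plane `⟪z - x, ν⟫ < 0`. There is at most one such `ν`. -/
def IsOutwardNormal (Ω : Set Plane) (x ν : Plane) : Prop :=
  ‖ν‖ = 1 ∧ ∀ ε > 0, ∀ᶠ z in 𝓝 x,
    (inner ℝ (z - x) ν < -ε * ‖z - x‖ → z ∈ Ω) ∧ (ε * ‖z - x‖ < inner ℝ (z - x) ν → z ∉ Ω)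

open Classical in
/-- The outward unit normal field, which a Lipschitz domain has at almost every boundary point
(and the value `0` where there is no normal). -/
def outwardNormal (Ω : Set Plane) (x : Plane) : Plane :=
  if hx : ∃ ν, IsOutwardNormal Ω x ν then hx.choose else 0

/-- The inflow part of the boundary for the velocity field `W`. -/
def inflowBoundary (Ω : Set Plane) (W : Plane → Plane) : Set Plane :=
  {y ∈ frontier Ω | inner ℝ (W y) (outwardNormal Ω y) < 0}

/-- `∫_{Γ_inflow} u² |W · n| ds`; the one-dimensional Hausdorff measure is arc length. -/
def inflowTerm (Ω : Set Plane) (W : Plane → Plane) (u : Plane → ℝ) : ℝ :=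
  ∫ y in inflowBoundary Ω W, u y ^ 2 * |inner ℝ (W y) (outwardNormal Ω y)| ∂(μH[1])

/-- The divergence of a vector field in the plane. -/
def divergence (W : Plane → Plane) (y : Plane) : ℝ :=
  ∑ i : Fin 2, (fderiv ℝ W y (EuclideanSpace.single i 1)) i

/-! ### Cardinal functions of Kansa's method and of RBF-PUM -/

/-- Exponents of the bivariate monomials of total degree at most `D`
(there are `(D + 2).choose 2` of them). -/
abbrev MonoIdx (D : ℕ) : Type :=
  {α : Fin (D + 1) × Fin (D + 1) // (α.1 : ℕ) + (α.2 : ℕ) ≤ D}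

/-- The monomial with exponent `α`. -/
def mono {D : ℕ} (α : MonoIdx D) (y : Plane) : ℝ :=
  y 0 ^ (α.1.1 : ℕ) * y 1 ^ (α.1.2 : ℕ)

/-- The interpolation matrix `[A P; Pᵀ 0]` for the radial functions `φ ‖· - x l‖` and the
monomials of degree at most `D`. -/
def interpMatrix {ι : Type*} (φ : ℝ → ℝ) (D : ℕ) (x : ι → Plane) :
    Matrix (ι ⊕ MonoIdx D) (ι ⊕ MonoIdx D) ℝ :=
  Matrix.fromBlocks (Matrix.of fun j l => φ ‖x j - x l‖) (Matrix.of fun j k => mono k (x j))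
    (Matrix.of fun j k => mono k (x j))ᵀ 0

/-- The row vector `b(y) = (φ₁(y), …, φ_N(y), p₁(y), …, p_m(y))`. -/
def interpRow {ι : Type*} (φ : ℝ → ℝ) (D : ℕ) (x : ι → Plane) (y : Plane) :
    ι ⊕ MonoIdx D → ℝ :=
  Sum.elim (fun l => φ ‖y - x l‖) (fun k => mono k y)

/-- The cardinal functions `Ψ_k(y) = [b(y) [A P; Pᵀ 0]⁻¹]_k` of the interpolant at the nodes `x`. -/
def kansaCardinal {ι : Type*} [Fintype ι] [DecidableEq ι] (φ : ℝ → ℝ) (D : ℕ) (x : ι → Plane)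
    (k : ι) (y : Plane) : ℝ :=
  (interpRow φ D x y ᵥ* (interpMatrix φ D x)⁻¹) (Sum.inl k)

/-- The `C²` Wendland function `(4 r + 1) (1 - r)₊⁴`. -/
def wendland (r : ℝ) : ℝ := (4 * r + 1) * max (1 - r) 0 ^ 4

/-- Shepard's partition of unity weights on the discs with centres `ξ j` and radii `R j`. -/
def shepardWeight {P : ℕ} (ξ : Fin P → Plane) (R : Fin P → ℝ) (j : Fin P) (y : Plane) : ℝ :=
  wendland (‖y - ξ j‖ / R j) / ∑ i, wendland (‖y - ξ i‖ / R i)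

/-- The indices of the nodes contained in the disc with centre `p` and radius `r`. -/
abbrev PatchIdx {N : ℕ} (X : Fin N → Plane) (p : Plane) (r : ℝ) : Type :=
  {i : Fin N // X i ∈ Metric.ball p r}

/-- The nodes contained in the disc with centre `p` and radius `r`. -/
def patchNodes {N : ℕ} (X : Fin N → Plane) (p : Plane) (r : ℝ) : PatchIdx X p r → Plane :=
  fun i => X i.1

open Classical in
/-- The RBF-PUM cardinal functions `Ψ_i = ∑ w_j ψ_i^(j)`, the sum being over the patches `j`
that contain the node `X i`. -/
def pumCardinal {N P : ℕ} (φ : ℝ → ℝ) (D : ℕ) (X : Fin N → Plane) (ξ : Fin P → Plane)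
    (R : Fin P → ℝ) (i : Fin N) (y : Plane) : ℝ :=
  ∑ j, if hi : X i ∈ Metric.ball (ξ j) (R j) then
    shepardWeight ξ R j y * kansaCardinal φ D (patchNodes X (ξ j) (R j)) ⟨i, hi⟩ y else 0

/-- `Ψ` is the family of cardinal functions of Kansa's global method at the nodes `X`, for some
radial basis function of class `C²` and some polynomial degree. -/
def IsKansaBasis {N : ℕ} (X : Fin N → Plane) (Ψ : Fin N → Plane → ℝ) : Prop :=
  ∃ (φ : ℝ → ℝ) (D : ℕ), ContDiff ℝ 2 (fun y : Plane => φ ‖y‖) ∧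
    IsUnit (interpMatrix φ D X) ∧ Ψ = kansaCardinal φ D X

open Classical in
/-- `Ψ` is the family of cardinal functions of RBF-PUM at the nodes `X`, for some radial basis
function of class `C²`, some polynomial degree and some cover of `closure Ω` by open discs. -/
def IsPUMBasis {N : ℕ} (Ω : Set Plane) (X : Fin N → Plane) (Ψ : Fin N → Plane → ℝ) : Prop :=
  ∃ (φ : ℝ → ℝ) (D P : ℕ) (ξ : Fin P → Plane) (R : Fin P → ℝ),
    ContDiff ℝ 2 (fun y : Plane => φ ‖y‖) ∧ (∀ j, 0 < R j) ∧
    closure Ω ⊆ ⋃ j, Metric.ball (ξ j) (R j) ∧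
    (∀ j, IsUnit (interpMatrix φ D (patchNodes X (ξ j) (R j)))) ∧ Ψ = pumCardinal φ D X ξ R

/-! ### The semi-discrete problem -/

/-- The mean node distance `h = (|Ω| / N)^{1/2}` of `N` nodes in `Ω`. -/
def nodeSpacing (Ω : Set Plane) (N : ℕ) : ℝ := Real.sqrt (volume.real Ω / N)

/-- `y` lists, without repetition, the points in `Ω` of a Cartesian grid of mesh size `hy`
(with an arbitrary offset `a`). -/
def IsCartesianSample {M : ℕ} (Ω : Set Plane) (hy : ℝ) (y : Fin M → Plane) : Prop :=
  Function.Injective y ∧ ∃ a : Plane,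
    range y = {z ∈ Ω | ∃ n : Fin 2 → ℤ, ∀ i, z i = a i + hy * n i}

/-- The function `∑ v_i Ψ_i` with nodal values `v`. -/
def ansatz {N : ℕ} (Ψ : Fin N → Plane → ℝ) (v : Fin N → ℝ) (z : Plane) : ℝ := ∑ i, v i * Ψ i z

/-- The scaled evaluation matrix `hy Ψ_i(y_k)`. -/
def evalMatrix {N M : ℕ} (Ψ : Fin N → Plane → ℝ) (hy : ℝ) (y : Fin M → Plane) :
    Matrix (Fin M) (Fin N) ℝ :=
  hy • Matrix.of fun k i => Ψ i (y k)

/-- The scaled advection matrix `-hy (W · ∇Ψ_i)(y_k)`. -/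
def advectionMatrix {N M : ℕ} (Ψ : Fin N → Plane → ℝ) (W : Plane → Plane) (hy : ℝ)
    (y : Fin M → Plane) : Matrix (Fin M) (Fin N) ℝ :=
  hy • Matrix.of fun k i => -(fderiv ℝ (Ψ i) (y k) (W (y k)))

/-- The nodal values `v : ℝ → (Fin N → ℝ)` solve on `[0, T]` the system of ODEs
`(Eᵀ E) ∂ₜ v = (Eᵀ D) v` obtained by the least-squares projection, for the velocity `V`. -/
def IsSemidiscreteSolution {N M : ℕ} (Ψ : Fin N → Plane → ℝ) (V : ℝ → Plane → Plane) (T hy : ℝ)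
    (y : Fin M → Plane) (v : ℝ → Fin N → ℝ) : Prop :=
  ∀ t ∈ Icc 0 T, ∃ v' : Fin N → ℝ, HasDerivWithinAt v v' (Icc 0 T) t ∧
    ((evalMatrix Ψ hy y)ᵀ * evalMatrix Ψ hy y) *ᵥ v' =
      ((evalMatrix Ψ hy y)ᵀ * advectionMatrix Ψ (V t) hy y) *ᵥ v t

/-- The squared discrete norm `‖u‖²_{ℓ₂} = hy² ∑ u(y_k)²`. -/
def discreteNormSq {M : ℕ} (hy : ℝ) (y : Fin M → Plane) (u : Plane → ℝ) : ℝ :=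
  hy ^ 2 * ∑ k, u (y k) ^ 2

/-! ### Norms on Voronoi cells and inverse inequalities -/

/-- The Voronoi cell of the node `X i` in `Ω`. -/
def voronoiCell {N : ℕ} (Ω : Set Plane) (X : Fin N → Plane) (i : Fin N) : Set Plane :=
  {y ∈ Ω | ∀ j, ‖y - X i‖ ≤ ‖y - X j‖}

/-- The supremum norm on `K`. For the continuous functions and the cells considered here this is
the `L_∞(K)` norm. -/
def supNorm {G : Type*} [Norm G] (K : Set Plane) (f : Plane → G) : ℝ := ⨆ z : K, ‖f z‖

/-- The inverse inequality `‖∇f‖_{L_∞(K_i)} ≤ κ h⁻¹ ‖f‖_{L_∞(K_i)}` on all Voronoi cells `K_i`,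
for all functions `f` of the set `S`. -/
def InverseInequality {N : ℕ} (Ω : Set Plane) (X : Fin N → Plane) (S : Set (Plane → ℝ)) (κ : ℝ) :
    Prop :=
  0 ≤ κ ∧ ∀ f ∈ S, ∀ i, supNorm (voronoiCell Ω X i) (fderiv ℝ f) ≤
    κ * (nodeSpacing Ω N)⁻¹ * supNorm (voronoiCell Ω X i) f

/-- The smallest constant in the inverse inequality. -/
def inverseConst {N : ℕ} (Ω : Set Plane) (X : Fin N → Plane) (S : Set (Plane → ℝ)) : ℝ :=
  sInf {κ | InverseInequality Ω X S κ}

/-- The trial space, spanned by the cardinal functions. -/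
def trialSpace {N : ℕ} (Ψ : Fin N → Plane → ℝ) : Set (Plane → ℝ) := range (ansatz Ψ)

/-- The integrands `u (W · ∇u)`, with `u` in the trial space. -/
def advectionIntegrands {N : ℕ} (Ψ : Fin N → Plane → ℝ) (W : Plane → Plane) :
    Set (Plane → ℝ) :=
  (fun (u : Plane → ℝ) (z : Plane) => u z * fderiv ℝ u z (W z)) '' trialSpace Ψ

/-- The constant `C_∫ = c (1 + C_{I,f})` of the integration error, with `C_{I,f}` the smallest
constant in the inverse inequality for the integrands `u (W · ∇u)`. -/
def integrationConst {N : ℕ} (c : ℝ) (Ω : Set Plane) (X : Fin N → Plane)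
    (Ψ : Fin N → Plane → ℝ) (W : Plane → Plane) : ℝ :=
  c * (1 + inverseConst Ω X (advectionIntegrands Ψ W))

/-- The constant `C = 2 C_∫ C_I`, with `C_I` the smallest constant in the inverse inequality for
the trial space. -/
def stabilityConst {N : ℕ} (c : ℝ) (Ω : Set Plane) (X : Fin N → Plane)
    (Ψ : Fin N → Plane → ℝ) (W : Plane → Plane) : ℝ :=
  2 * integrationConst c Ω X Ψ W * inverseConst Ω X (trialSpace Ψ)

/-- `max_i ‖u (W · ∇u)‖_{L_∞(K_i)}` over the Voronoi cells `K_i`. -/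
def integrandMax {N : ℕ} (Ω : Set Plane) (X : Fin N → Plane) (W : Plane → Plane)
    (u : Plane → ℝ) : ℝ :=
  ⨆ i, supNorm (voronoiCell Ω X i) (fun z => u z * fderiv ℝ u z (W z))

/-- `max_i ‖W‖_{L_∞(K_i)} ‖u‖²_{L_∞(K_i)}` over the Voronoi cells `K_i`. -/
def velocityEnergyMax {N : ℕ} (Ω : Set Plane) (X : Fin N → Plane) (W : Plane → Plane)
    (u : Plane → ℝ) : ℝ :=
  ⨆ i, supNorm (voronoiCell Ω X i) W * supNorm (voronoiCell Ω X i) u ^ 2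

end

/-! Testing the least-squares system with the nodal values of `u_h` gives an exact energy identity:
the time derivative of `‖u_h‖²` is `-2` times the Cartesian grid sum of `f = u_h (F' · ∇u_h)`. The
estimate then follows by comparing this sum with the integral of `f`.

The integral. As `F'` is solenoidal, `2 f` is the divergence of `u_h² F'`, so `-2 ∫ f` is minus the
flux of `u_h² F'` through the boundary, hence at most the inflow integral
(`neg_two_integral_advection_le`). Only this upper bound is needed. It is obtained by a partition of
unity from charts in which `Ω` lies below a Lipschitz graph, and since the inward flux density is
nonnegative it suffices that arc length is dominated by Hausdorff measure.

The quadrature error. The grid sum is the integral of a step function. It differs from `f` by mesh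
size times gradient where the step stays in `Ω`, and by at most twice the supremum of `|f|` in a
boundary layer whose area is proportional to the mesh size (`exists_quadrature_error_le`). The
inverse inequality for the integrands replaces the gradient by `C_{I,f} h⁻¹` times the supremum,
which leaves a constant `c` depending on `Ω` alone.

The inverse inequalities. The functions in question lie in finite-dimensional spaces, and on a
Voronoi cell a function that vanishes has vanishing gradient, because the cell lies in the closure
of its interior. The gradient is therefore a bounded linear function of the restriction to the cell
(`exists_inverse_bound`). For constant velocities a single finite-dimensional space contains all the
integrands, whence the uniform bound. All this needs the basis to be `C²` in a neighbourhood of the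
closure of `Ω` (`exists_contDiffOn_cardinal`). -/

/-! ### Regularity of the cardinal functions -/

section Regularity

variable {E : Type*} [NormedAddCommGroup E] [InnerProductSpace ℝ E]

/-- The map `y ↦ ‖y‖ • y` is continuously differentiable, also at the origin. -/
theorem contDiff_norm_smul_self : ContDiff ℝ 1 (fun y : E => ‖y‖ • y) := by
  -- The derivative by the product rule off the origin; at the origin both terms vanish, which is
  -- again the right value.
  set D : E → E →L[ℝ] E := fun y =>
    ‖y‖ • ContinuousLinearMap.id ℝ E + (‖y‖⁻¹ • innerSL ℝ y).smulRight y with hD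
  have hD0 : D 0 = 0 := by simp [hD]
  have hder : ∀ y, HasFDerivAt (fun y : E => ‖y‖ • y) (D y) y := by
    intro y
    rcases eq_or_ne y 0 with rfl | hy
    · rw [hD0, hasFDerivAt_iff_isLittleO_nhds_zero]
      have h : (fun h : E => ‖0 + h‖ • (0 + h) - ‖(0 : E)‖ • (0 : E) - (0 : E →L[ℝ] E) h)
          = fun h => ‖h‖ • h := by ext; simp
      rw [h, Asymptotics.isLittleO_iff]
      intro c hc
      filter_upwards [Metric.ball_mem_nhds (0 : E) hc] with z hz
      rw [mem_ball_zero_iff] at hz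
      rw [norm_smul, norm_norm]
      gcongr
    · have h1 : HasFDerivAt (fun y : E => ‖y‖) (‖y‖⁻¹ • innerSL ℝ y) y := by
        have h2 := (hasStrictFDerivAt_norm_sq y).hasFDerivAt
        have h3 := h2.sqrt (by positivity)
        have h4 : (fun y : E => √(‖y‖ ^ 2)) = fun y => ‖y‖ := by
          ext z; exact Real.sqrt_sq (norm_nonneg z)
        rw [h4] at h3
        convert h3 using 1
        rw [Real.sqrt_sq (norm_nonneg y), ← Nat.cast_smul_eq_nsmul ℝ, smul_smul]
        congr 1
        field_simp
        norm_num
      exact h1.smul (hasFDerivAt_id y)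
  have hcont : Continuous D := by
    rw [continuous_iff_continuousAt]
    intro y
    rcases eq_or_ne y 0 with rfl | hy
    · rw [ContinuousAt, hD0]
      apply squeeze_zero_norm (a := fun y : E => 2 * ‖y‖)
      · intro z
        have h1 : ‖(‖z‖⁻¹ • innerSL ℝ z).smulRight z‖ ≤ ‖z‖ := by
          rw [ContinuousLinearMap.norm_smulRight_apply, norm_smul, norm_inv, norm_norm,
            innerSL_apply_norm]
          rcases eq_or_ne z 0 with rfl | hz
          · simp
          · rw [inv_mul_cancel₀ (norm_ne_zero_iff.mpr hz), one_mul]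
        have h2 : ‖‖z‖ • ContinuousLinearMap.id ℝ E‖ ≤ ‖z‖ := by
          rw [norm_smul, norm_norm]
          exact mul_le_of_le_one_right (norm_nonneg _) ContinuousLinearMap.norm_id_le
        calc ‖D z‖ ≤ _ + _ := norm_add_le _ _
          _ ≤ 2 * ‖z‖ := by linarith
      · have : Continuous fun y : E => 2 * ‖y‖ := by fun_prop
        simpa using this.tendsto 0
    · have h1 : ContinuousAt (fun y : E => ‖y‖⁻¹) y :=
        continuous_norm.continuousAt.inv₀ (norm_ne_zero_iff.mpr hy)
      have h2 : Continuous fun y : E => innerSL ℝ y := (innerSL ℝ).continuous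
      have h3 : ContinuousAt (fun y : E => ‖y‖⁻¹ • innerSL ℝ y) y := h1.smul h2.continuousAt
      have h4 : ContinuousAt (fun y : E => ‖y‖ • ContinuousLinearMap.id ℝ E) y := by fun_prop
      refine h4.add ?_
      exact ((ContinuousLinearMap.smulRightL ℝ E E).continuous.continuousAt.comp h3).clm_apply
        continuousAt_id
  rw [contDiff_one_iff_fderiv]
  refine ⟨fun y => (hder y).differentiableAt, ?_⟩
  rwa [show fderiv ℝ (fun y : E => ‖y‖ • y) = D from funext fun y => (hder y).fderiv]

/-- The gradient is `3 ‖y‖ y`, which is `C¹` by `contDiff_norm_smul_self`. This handles the odd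
powers of the Wendland function at the centre of a disc. -/
theorem contDiff_norm_cube : ContDiff ℝ 2 (fun y : E => ‖y‖ ^ 3) := by
  have hder : ∀ y : E, HasFDerivAt (fun y : E => ‖y‖ ^ 3) ((3 : ℝ) • innerSL ℝ (‖y‖ • y)) y := by
    intro y
    have h := hasFDerivAt_norm_rpow y (p := 3) (by norm_num)
    have h1 : (fun x : E => ‖x‖ ^ (3 : ℝ)) = fun x => ‖x‖ ^ 3 := by
      ext x; exact_mod_cast Real.rpow_natCast ‖x‖ 3
    rw [h1] at h
    convert h using 1
    rw [map_smul, smul_smul, show (3 : ℝ) - 2 = 1 by norm_num, Real.rpow_one]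
  rw [show (2 : WithTop ℕ∞) = 1 + 1 by norm_num, contDiff_succ_iff_fderiv]
  refine ⟨fun y => (hder y).differentiableAt, by simp, ?_⟩
  rw [show fderiv ℝ (fun y : E => ‖y‖ ^ 3) = fun y => (3 : ℝ) • innerSL ℝ (‖y‖ • y) from
    funext fun y => (hder y).fderiv]
  exact ((innerSL ℝ).contDiff.comp contDiff_norm_smul_self).const_smul _

/-- By induction, since differentiation lowers the exponent of the truncated power by one; only the
point `0` needs an estimate. -/
theorem contDiff_max_zero_pow (n : ℕ) : ContDiff ℝ n (fun s : ℝ => max s 0 ^ (n + 1)) := by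
  induction n with
  | zero => exact contDiff_zero.2 (by fun_prop)
  | succ n ih =>
    have hder : ∀ s : ℝ, HasDerivAt (fun s : ℝ => max s 0 ^ (n + 1 + 1))
        ((n + 1 + 1 : ℕ) * max s 0 ^ (n + 1)) s := by
      intro s
      rcases lt_trichotomy s 0 with hs | rfl | hs
      · have h : (fun s : ℝ => max s 0 ^ (n + 1 + 1)) =ᶠ[𝓝 s] fun _ => 0 := by
          filter_upwards [Iio_mem_nhds hs] with r hr
          rw [max_eq_right (le_of_lt hr)]; simp
        rw [max_eq_right hs.le]
        simpa using (hasDerivAt_const s (0 : ℝ)).congr_of_eventuallyEq h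
      · rw [hasDerivAt_iff_isLittleO_nhds_zero, Asymptotics.isLittleO_iff]
        intro c hc
        filter_upwards [Metric.ball_mem_nhds (0 : ℝ) (lt_min hc one_pos)] with z hz
        rw [mem_ball_zero_iff] at hz
        have hz1 : ‖max z 0‖ ≤ ‖z‖ := by
          rw [Real.norm_eq_abs, Real.norm_eq_abs, abs_of_nonneg (le_max_right _ _)]
          exact max_le (le_abs_self z) (abs_nonneg z)
        have h2 : ‖z‖ ^ (n + 1) ≤ c := by
          calc ‖z‖ ^ (n + 1) ≤ ‖z‖ ^ 1 :=
                pow_le_pow_of_le_one (norm_nonneg z) (hz.le.trans (min_le_right _ _)) (by omega)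
            _ ≤ c := by rw [pow_one]; exact hz.le.trans (min_le_left _ _)
        have h3 : ‖max z 0‖ ^ (n + 1 + 1) ≤ c * ‖z‖ := by
          calc ‖max z 0‖ ^ (n + 1 + 1) ≤ ‖z‖ ^ (n + 1 + 1) := by gcongr
            _ = ‖z‖ ^ (n + 1) * ‖z‖ := pow_succ _ _
            _ ≤ c * ‖z‖ := by gcongr
        simpa using h3
      · have h : (fun s : ℝ => max s 0 ^ (n + 1 + 1)) =ᶠ[𝓝 s] fun r => r ^ (n + 1 + 1) := by
          filter_upwards [Ioi_mem_nhds hs] with r hr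
          rw [max_eq_left (le_of_lt hr)]
        rw [max_eq_left hs.le]
        exact (hasDerivAt_pow (n + 1 + 1) s).congr_of_eventuallyEq h
    rw [show ((n + 1 : ℕ) : WithTop ℕ∞) = (n : WithTop ℕ∞) + 1 by push_cast; rfl,
      contDiff_succ_iff_deriv]
    refine ⟨fun s => (hder s).differentiableAt, by simp, ?_⟩
    rw [show deriv (fun s : ℝ => max s 0 ^ (n + 1 + 1)) =
      fun s => ((n + 1 + 1 : ℕ) : ℝ) * max s 0 ^ (n + 1) from funext fun s => (hder s).deriv]
    exact contDiff_const.mul ih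

/-- At the origin the linear terms of the expansion cancel, so only products of `‖y‖²` and `‖y‖³`
remain. Elsewhere the norm is smooth and the truncated power is smooth enough. -/
theorem contDiff_wendland_norm : ContDiff ℝ 2 (fun y : E => wendland ‖y‖) := by
  rw [contDiff_iff_contDiffAt]
  intro y
  rcases eq_or_ne y 0 with rfl | hy
  · have h : (fun y : E => wendland ‖y‖) =ᶠ[𝓝 0] fun y =>
        1 - 10 * ‖y‖ ^ 2 + 20 * ‖y‖ ^ 3 - 15 * (‖y‖ ^ 2) ^ 2 + 4 * (‖y‖ ^ 2 * ‖y‖ ^ 3) := by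
      filter_upwards [Metric.ball_mem_nhds (0 : E) one_pos] with z hz
      rw [mem_ball_zero_iff] at hz
      rw [wendland, max_eq_left (by linarith)]
      ring
    refine ContDiffAt.congr_of_eventuallyEq ?_ h
    have h2 : ContDiff ℝ 2 (fun y : E => ‖y‖ ^ 2) := contDiff_norm_sq ℝ
    have h3 : ContDiff ℝ 2 (fun y : E => ‖y‖ ^ 3) := contDiff_norm_cube
    exact ((((contDiff_const.sub (contDiff_const.mul h2)).add (contDiff_const.mul h3)).sub
      (contDiff_const.mul (h2.pow 2))).add (contDiff_const.mul (h2.mul h3))).contDiffAt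
  · have h1 : ContDiff ℝ 2 (fun r : ℝ => wendland r) := by
      have h : ContDiff ℝ 2 (fun s : ℝ => max s 0 ^ 4) :=
        (contDiff_max_zero_pow 3).of_le (by norm_num)
      have h' : ContDiff ℝ 2 (fun r : ℝ => max (1 - r) 0 ^ 4) :=
        h.comp (contDiff_const.sub contDiff_id)
      unfold wendland
      fun_prop
    exact h1.contDiffAt.comp y (contDiffAt_norm ℝ hy)

theorem wendland_nonneg {r : ℝ} (hr : 0 ≤ r) : 0 ≤ wendland r := by
  unfold wendland; positivity

theorem wendland_pos {r : ℝ} (hr : 0 ≤ r) (hr' : r < 1) : 0 < wendland r := by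
  rw [wendland, max_eq_left (by linarith)]
  have : 0 < 1 - r := by linarith
  positivity

end Regularity

theorem contDiff_wendland_patch (ξ : Plane) {R : ℝ} (hR : 0 < R) :
    ContDiff ℝ 2 (fun y : Plane => wendland (‖y - ξ‖ / R)) := by
  have h : (fun y : Plane => wendland (‖y - ξ‖ / R)) =
      (fun y : Plane => wendland ‖y‖) ∘ fun y => R⁻¹ • (y - ξ) := by
    ext y
    simp [norm_smul, abs_of_pos hR, div_eq_inv_mul]
  rw [h]
  exact contDiff_wendland_norm.comp (by fun_prop)

/-- Inside the union of the discs some Wendland function is positive, so the denominator does not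
vanish; outside it the quotient is `0 / 0`. -/
theorem contDiffAt_shepardWeight {P : ℕ} {ξ : Fin P → Plane} {R : Fin P → ℝ} (hR : ∀ j, 0 < R j)
    {y : Plane} (hy : y ∈ ⋃ j, Metric.ball (ξ j) (R j)) (j : Fin P) :
    ContDiffAt ℝ 2 (shepardWeight ξ R j) y := by
  obtain ⟨k, hk⟩ := mem_iUnion.1 hy
  rw [mem_ball_iff_norm] at hk
  have hpos : 0 < ∑ i, wendland (‖y - ξ i‖ / R i) :=
    Finset.sum_pos' (fun i _ => wendland_nonneg (div_nonneg (norm_nonneg _) (hR i).le))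
      ⟨k, Finset.mem_univ _, wendland_pos (div_nonneg (norm_nonneg _) (hR k).le)
        ((div_lt_one (hR k)).2 hk)⟩
  exact (contDiff_wendland_patch (ξ j) (hR j)).contDiffAt.div
    (ContDiff.sum fun i _ => contDiff_wendland_patch (ξ i) (hR i)).contDiffAt hpos.ne'

theorem contDiff_mono {D : ℕ} (α : MonoIdx D) : ContDiff ℝ 2 (mono α) := by
  unfold mono
  fun_prop

theorem contDiff_kansaCardinal {ι : Type*} [Fintype ι] [DecidableEq ι] {φ : ℝ → ℝ}
    (hφ : ContDiff ℝ 2 (fun y : Plane => φ ‖y‖)) (D : ℕ) (x : ι → Plane) (k : ι) :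
    ContDiff ℝ 2 (kansaCardinal φ D x k) := by
  unfold kansaCardinal Matrix.vecMul dotProduct
  refine ContDiff.sum fun i _ => ContDiff.mul ?_ contDiff_const
  rcases i with l | α
  · exact hφ.comp (contDiff_id.sub contDiff_const)
  · exact contDiff_mono α

-- The only information about the two methods that the rest of the proof uses. The neighbourhood `U`
-- gives bounds up to the boundary; for RBF-PUM it is the union of the discs.
open Classical in
theorem exists_contDiffOn_cardinal {N : ℕ} {Ω : Set Plane} {X : Fin N → Plane}
    {Ψ : Fin N → Plane → ℝ} (h : IsKansaBasis X Ψ ∨ IsPUMBasis Ω X Ψ) :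
    ∃ U, IsOpen U ∧ closure Ω ⊆ U ∧ ∀ i, ContDiffOn ℝ 2 (Ψ i) U := by
  rcases h with ⟨φ, D, hφ, -, rfl⟩ | ⟨φ, D, P, ξ, R, hφ, hR, hcov, -, rfl⟩
  · exact ⟨univ, isOpen_univ, subset_univ _, fun i =>
      (contDiff_kansaCardinal hφ D X i).contDiffOn⟩
  · refine ⟨⋃ j, Metric.ball (ξ j) (R j), isOpen_iUnion fun j => Metric.isOpen_ball, hcov,
      fun i y hy => ContDiffAt.contDiffWithinAt ?_⟩
    unfold pumCardinal
    refine ContDiffAt.sum fun j _ => ?_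
    split_ifs with hi
    · exact (contDiffAt_shepardWeight hR hy j).mul
        (contDiff_kansaCardinal hφ D _ _).contDiffAt
    · exact contDiffAt_const

/-! ### The divergence theorem below a Lipschitz graph -/

section Subgraph

/-- Integration by parts against the constant `1`. -/
theorem integral_deriv_eq_zero_of_lipschitzWith {f : ℝ → ℝ} {K : ℝ≥0} (hf : LipschitzWith K f)
    (hs : HasCompactSupport f) : ∫ x, deriv f x = 0 := by
  have h := LipschitzWith.integral_lineDeriv_mul_eq (μ := volume)
    (LipschitzWith.const (1 : ℝ) : LipschitzWith 0 fun _ : ℝ => (1 : ℝ)) hf hs (-1)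
  have h1 : ∀ x, lineDeriv ℝ f x 1 = deriv f x := by
    intro x
    rw [lineDeriv]
    simp only [smul_eq_mul, mul_one]
    rw [deriv_comp_const_add, add_zero]
  simp only [neg_neg, h1, mul_one] at h
  rw [← h]
  simp [lineDeriv]

/-- The shear `(x, s) ↦ (x, g x + s)` along a continuous function. -/
def shearHomeomorph (g : ℝ → ℝ) (hg : Continuous g) : ℝ × ℝ ≃ₜ ℝ × ℝ where
  toFun p := (p.1, g p.1 + p.2)
  invFun p := (p.1, p.2 - g p.1)
  left_inv p := by simp
  right_inv p := by simp
  continuous_toFun := by fun_prop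
  continuous_invFun := by fun_prop

theorem measurePreserving_shear {g : ℝ → ℝ} (hg : Continuous g) :
    MeasurePreserving (shearHomeomorph g hg) := by
  refine MeasurePreserving.skew_product (μa := (volume : Measure ℝ)) (μc := (volume : Measure ℝ))
    (μb := volume) (μd := volume) (f := id) (g := fun x s => g x + s)
    (MeasurePreserving.id _) (by fun_prop) ?_
  exact Eventually.of_forall fun x => map_add_left_eq_self _ _

variable {F : ℝ × ℝ → ℝ} {g : ℝ → ℝ} {K : ℝ≥0}

/-- The area-preserving shear straightens the subgraph to a half plane, where Fubini applies. -/
theorem setIntegral_subgraph {Φ : ℝ × ℝ → ℝ} (hΦ : Continuous Φ) (hs : HasCompactSupport Φ)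
    (hg : Continuous g) :
    ∫ p in {p : ℝ × ℝ | p.2 < g p.1}, Φ p = ∫ x, ∫ s in Iio 0, Φ (x, g x + s) := by
  have hpre : (shearHomeomorph g hg) ⁻¹' {p : ℝ × ℝ | p.2 < g p.1} = univ ×ˢ Iio 0 := by
    ext p; simp [shearHomeomorph]
  rw [← (measurePreserving_shear hg).setIntegral_preimage_emb
    (shearHomeomorph g hg).measurableEmbedding, hpre, Measure.volume_eq_prod, setIntegral_prod,
    setIntegral_univ]
  · rfl
  · have h1 : HasCompactSupport (Φ ∘ shearHomeomorph g hg) := hs.comp_homeomorph _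
    exact ((hΦ.comp (shearHomeomorph g hg).continuous).integrable_of_hasCompactSupport
      h1).integrableOn

theorem setIntegral_Iio_fderiv (hF : ContDiff ℝ 1 F) (hs : HasCompactSupport F) (x b : ℝ) :
    ∫ s in Iio 0, fderiv ℝ F (x, b + s) (0, 1) = F (x, b) := by
  have hemb : Topology.IsClosedEmbedding fun s : ℝ => (x, b + s) := by
    refine Topology.IsClosedEmbedding.of_continuous_injective_isClosedMap (by fun_prop)
      (fun s t h => by simpa using h) ?_
    have h := (Homeomorph.addLeft b).isClosedMap
    intro A hA
    have : (fun s : ℝ => (x, b + s)) '' A = {x} ×ˢ ((fun s => b + s) '' A) := by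
      rw [singleton_prod, image_image]
    rw [this]
    exact isClosed_singleton.prod (h A hA)
  have hs' : HasCompactSupport fun s : ℝ => F (x, b + s) := hs.comp_isClosedEmbedding hemb
  have hC : ContDiff ℝ 1 fun s : ℝ => F (x, b + s) := hF.comp (by fun_prop)
  have h := hs'.integral_Iic_deriv_eq hC 0
  rw [integral_Iic_eq_integral_Iio, add_zero] at h
  rw [← h]
  congr 1
  ext s
  have h1 : HasDerivAt (fun s : ℝ => (x, b + s)) (0, 1) s :=
    (hasDerivAt_const s x).prodMk ((hasDerivAt_id s).const_add b)
  exact (((hF.differentiable (by simp)) (x, b + s)).hasFDerivAt.comp_hasDerivAt s h1).deriv.symm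

theorem setIntegral_subgraph_fderiv_snd (hF : ContDiff ℝ 1 F) (hs : HasCompactSupport F)
    (hg : LipschitzWith K g) :
    ∫ p in {p : ℝ × ℝ | p.2 < g p.1}, fderiv ℝ F p (0, 1) = ∫ x, F (x, g x) := by
  rw [setIntegral_subgraph ((hF.continuous_fderiv (by simp)).clm_apply continuous_const)
    (hs.fderiv_apply ℝ _) hg.continuous]
  simp_rw [setIntegral_Iio_fderiv hF hs]

/-- The integrand is almost everywhere the derivative of the compactly supported Lipschitz function
`x ↦ F (x, g x + s)`, by the chain rule and Rademacher's theorem for `g`. -/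
theorem integral_fderiv_fst_shear (hF : ContDiff ℝ 1 F) (hs : HasCompactSupport F)
    (hg : LipschitzWith K g) (s : ℝ) :
    ∫ x, (fderiv ℝ F (x, g x + s) (1, 0) + deriv g x * fderiv ℝ F (x, g x + s) (0, 1)) = 0 := by
  obtain ⟨C, hC⟩ := hF.lipschitzWith_of_hasCompactSupport hs (by simp)
  have hL : LipschitzWith (C * (max 1 (K + 0))) fun x : ℝ => F (x, g x + s) :=
    hC.comp (LipschitzWith.id.prodMk (hg.add (LipschitzWith.const s)))
  have hcs : HasCompactSupport fun x : ℝ => F (x, g x + s) := by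
    have h1 : HasCompactSupport (F ∘ shearHomeomorph g hg.continuous) := hs.comp_homeomorph _
    refine HasCompactSupport.of_support_subset_isCompact (h1.isCompact.image continuous_fst) ?_
    intro x hx
    exact ⟨(x, s), subset_tsupport _ hx, rfl⟩
  refine Eq.trans (integral_congr_ae ?_) (integral_deriv_eq_zero_of_lipschitzWith hL hcs)
  filter_upwards [hg.ae_differentiableAt_of_real] with x hx
  have h1 : HasDerivAt (fun x : ℝ => (x, g x + s)) (1, deriv g x) x :=
    (hasDerivAt_id x).prodMk (hx.hasDerivAt.add_const s)
  have h2 := ((hF.differentiable (by simp)) (x, g x + s)).hasFDerivAt.comp_hasDerivAt x h1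
  refine Eq.trans ?_ h2.deriv.symm
  have h3 : ((1 : ℝ), deriv g x) = (1, 0) + deriv g x • (0, 1) := by simp
  rw [h3, map_add, map_smul, smul_eq_mul]

theorem integrable_comp_shear {Φ : ℝ × ℝ → ℝ} (hΦ : Continuous Φ) (hs : HasCompactSupport Φ)
    (hg : Continuous g) :
    Integrable (fun p : ℝ × ℝ => Φ (p.1, g p.1 + p.2)) :=
  (hΦ.comp (shearHomeomorph g hg).continuous).integrable_of_hasCompactSupport
    (hs.comp_homeomorph (shearHomeomorph g hg))

/-- `integral_fderiv_fst_shear` is integrated over `s < 0`. Curves parallel to the graph never cross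
it, so the boundary contribution comes only from the `deriv g` term, which is a total derivative in
`s`. -/
theorem setIntegral_subgraph_fderiv_fst (hF : ContDiff ℝ 1 F) (hs : HasCompactSupport F)
    (hg : LipschitzWith K g) :
    ∫ p in {p : ℝ × ℝ | p.2 < g p.1}, fderiv ℝ F p (1, 0) = -∫ x, deriv g x * F (x, g x) := by
  have hc : ∀ w : ℝ × ℝ, Continuous fun p => fderiv ℝ F p w := fun w =>
    (hF.continuous_fderiv (by simp)).clm_apply continuous_const
  have hi : ∀ w : ℝ × ℝ, Integrable (fun p : ℝ × ℝ => fderiv ℝ F (p.1, g p.1 + p.2) w)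
      (volume.prod volume) := fun w =>
    integrable_comp_shear (hc w) (hs.fderiv_apply ℝ w) hg.continuous
  have hi2 : Integrable (fun p : ℝ × ℝ => deriv g p.1 * fderiv ℝ F (p.1, g p.1 + p.2) (0, 1))
      (volume.prod volume) := by
    refine (hi (0, 1)).bdd_mul (c := K) ?_ ?_
    · exact ((measurable_deriv g).comp measurable_fst).aestronglyMeasurable
    · exact Eventually.of_forall fun p => norm_deriv_le_of_lipschitz hg
  have hres : (volume.prod volume : Measure (ℝ × ℝ)).restrict (univ ×ˢ Iio 0) =
      volume.prod (volume.restrict (Iio 0)) := by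
    rw [← Measure.prod_restrict, Measure.restrict_univ]
  have hr : ∀ {Φ : ℝ × ℝ → ℝ}, Integrable Φ (volume.prod volume) →
      Integrable Φ (volume.prod (volume.restrict (Iio 0))) := fun {Φ} h => by
    rw [← hres]; exact h.restrict
  rw [setIntegral_subgraph (hc _) (hs.fderiv_apply ℝ _) hg.continuous]
  have h0 : ∫ x, ∫ s in Iio 0, (fderiv ℝ F (x, g x + s) (1, 0) +
      deriv g x * fderiv ℝ F (x, g x + s) (0, 1)) = 0 := by
    have hadd := hr ((hi (1, 0)).add hi2)
    rw [integral_integral_swap (f := fun x s => fderiv ℝ F (x, g x + s) (1, 0) +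
      deriv g x * fderiv ℝ F (x, g x + s) (0, 1)) hadd]
    simp_rw [integral_fderiv_fst_shear hF hs hg]
    simp
  have h1 : ∫ x, ∫ s in Iio 0, (fderiv ℝ F (x, g x + s) (1, 0) +
      deriv g x * fderiv ℝ F (x, g x + s) (0, 1)) =
      (∫ x, ∫ s in Iio 0, fderiv ℝ F (x, g x + s) (1, 0)) +
      ∫ x, ∫ s in Iio 0, deriv g x * fderiv ℝ F (x, g x + s) (0, 1) :=
    integral_integral_add (hr (hi _)) (hr hi2)
  simp_rw [integral_const_mul, setIntegral_Iio_fderiv hF hs] at h1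
  linarith

end Subgraph

/-! ### Arc length and Hausdorff measure -/

section ArcLength

open scoped ENNReal

theorem hausdorffMeasure_image_Icc_lt_top {E : Type*} [EMetricSpace E] [MeasurableSpace E]
    [BorelSpace E] {γ : ℝ → E} {K : ℝ≥0} (hγ : LipschitzWith K γ) (a b : ℝ) :
    μH[1] (γ '' Icc a b) < ∞ := by
  have h := (hγ.lipschitzOnWith (s := Icc a b)).hausdorffMeasure_image_le (d := 1) zero_le_one
  refine h.trans_lt ?_
  rw [hausdorffMeasure_real, Real.volume_Icc]
  exact ENNReal.mul_lt_top (ENNReal.rpow_lt_top_of_nonneg zero_le_one ENNReal.coe_ne_top)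
    ENNReal.ofReal_lt_top

/-- Symmetric quotients are used because the differentiation theorem for measures works with the
intervals `[x - r, x + r]`. -/
theorem HasDerivAt.tendsto_symm_slope {E : Type*} [NormedAddCommGroup E]
    [NormedSpace ℝ E] {γ : ℝ → E} {γ' : E} {x : ℝ} (h : HasDerivAt γ γ' x) :
    Tendsto (fun r : ℝ => ‖γ (x + r) - γ (x - r)‖ / (2 * r)) (𝓝[>] 0) (𝓝 ‖γ'‖) := by
  have h1 : HasDerivAt (fun r : ℝ => γ (x + r) - γ (x - r)) ((2 : ℝ) • γ') 0 := by
    have ha : HasDerivAt (fun r : ℝ => γ (x + r)) γ' 0 :=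
      HasDerivAt.comp_const_add x 0 (by simpa using h)
    have hb : HasDerivAt (fun r : ℝ => γ (x - r)) (-γ') 0 :=
      HasDerivAt.comp_const_sub x 0 (by simpa using h)
    rw [two_smul]
    simpa using ha.fun_sub hb
  have h2 := (h1.tendsto_slope_zero_right).norm
  simp only [zero_add, add_zero, sub_zero, sub_self, norm_smul, norm_inv, Real.norm_eq_abs] at h2
  have h3 := h2.const_mul (2⁻¹ : ℝ)
  simp only [abs_two, ← mul_assoc] at h3
  norm_num at h3
  refine h3.congr' ?_
  filter_upwards [self_mem_nhdsWithin] with r hr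
  rw [abs_of_pos (show (0 : ℝ) < r from hr)]
  have : r ≠ 0 := ne_of_gt hr
  field_simp

variable {E : Type*} [NormedAddCommGroup E] [InnerProductSpace ℝ E] [MeasurableSpace E]
  [BorelSpace E] {γ : ℝ → E}

/-- Orthogonal projection onto the chord direction does not increase Hausdorff measure, and by the
intermediate value theorem the image covers an interval as long as the chord. -/
theorem ofReal_norm_sub_le_hausdorffMeasure_image {a b : ℝ} (hab : a ≤ b)
    (hγ : ContinuousOn γ (Icc a b)) :
    ENNReal.ofReal ‖γ b - γ a‖ ≤ μH[1] (γ '' Icc a b) := by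
  set w := γ b - γ a with hw
  rcases eq_or_ne w 0 with h0 | h0
  · simp [h0]
  set L : E →L[ℝ] ℝ := innerSL ℝ (‖w‖⁻¹ • w) with hL
  have hnL : ‖L‖₊ = 1 := by
    rw [← NNReal.coe_inj, coe_nnnorm, hL, innerSL_apply_norm, norm_smul, norm_inv, norm_norm,
      inv_mul_cancel₀ (norm_ne_zero_iff.2 h0), NNReal.coe_one]
  have h1 := (L.lipschitz.lipschitzOnWith (s := γ '' Icc a b)).hausdorffMeasure_image_le
    (d := 1) zero_le_one
  rw [hnL, hausdorffMeasure_real] at h1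
  have h2 : Icc (L (γ a)) (L (γ b)) ⊆ L '' (γ '' Icc a b) := by
    rw [image_image]
    exact intermediate_value_Icc hab (L.continuous.comp_continuousOn hγ)
  have h3 : L (γ b) - L (γ a) = ‖w‖ := by
    rw [← map_sub, ← hw, hL, innerSL_apply_apply, real_inner_smul_left,
      real_inner_self_eq_norm_sq]
    field_simp
  calc ENNReal.ofReal ‖w‖ = volume (Icc (L (γ a)) (L (γ b))) := by rw [Real.volume_Icc, h3]
    _ ≤ volume (L '' (γ '' Icc a b)) := measure_mono h2
    _ ≤ _ := by simpa using h1

variable {K : ℝ≥0}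

/-- The length of a Lipschitz curve is at most the Hausdorff measure of its trace. -/
theorem withDensity_norm_deriv_le_comap_hausdorffMeasure (hγ : LipschitzWith K γ)
    (hm : MeasurableEmbedding γ) (hd : ∀ᵐ x, DifferentiableAt ℝ γ x) :
    volume.withDensity (fun x => ENNReal.ofReal ‖deriv γ x‖) ≤ (μH[1]).comap γ := by
  set ν : Measure ℝ := (μH[1]).comap γ with hν
  have hνA : ∀ A, ν A = μH[1] (γ '' A) := fun A => hm.comap_apply _ _
  have : IsLocallyFiniteMeasure ν := ⟨fun x => ⟨Icc (x - 1) (x + 1),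
    Icc_mem_nhds (by linarith) (by linarith), by
      rw [hνA]; exact hausdorffMeasure_image_Icc_lt_top hγ _ _⟩⟩
  -- It suffices to bound the density of `ν` from below. Almost everywhere it is the limit of mass
  -- over length on shrinking intervals, and the mass of an interval is at least the chord of the
  -- curve over it.
  refine le_trans ?_ (Measure.withDensity_rnDeriv_le ν volume)
  refine withDensity_mono ?_
  filter_upwards [Besicovitch.ae_tendsto_rnDeriv ν volume, hd] with x hx hdx
  refine le_of_tendsto_of_tendsto (ENNReal.continuous_ofReal.continuousAt.tendsto.comp
    hdx.hasDerivAt.tendsto_symm_slope) hx ?_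
  filter_upwards [self_mem_nhdsWithin] with r hr
  have hr0 : (0 : ℝ) < r := hr
  rw [Real.volume_closedBall, hνA, Real.closedBall_eq_Icc, Function.comp_apply,
    ENNReal.ofReal_div_of_pos (by positivity)]
  gcongr
  exact ofReal_norm_sub_le_hausdorffMeasure_image (by linarith) hγ.continuous.continuousOn

end ArcLength

/-! ### Graph charts of a Lipschitz domain -/

section Chart

/-- Cartesian coordinates with respect to the orthonormal frame which `e` maps to the
standard one. -/
noncomputable def frameMap (e : Plane ≃ₗᵢ[ℝ] Plane) : ℝ × ℝ →L[ℝ] Plane :=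
  (ContinuousLinearMap.fst ℝ ℝ ℝ).smulRight (e.symm (EuclideanSpace.single 0 1)) +
    (ContinuousLinearMap.snd ℝ ℝ ℝ).smulRight (e.symm (EuclideanSpace.single 1 1))

variable (e : Plane ≃ₗᵢ[ℝ] Plane)

theorem frameMap_apply (p : ℝ × ℝ) : frameMap e p =
    p.1 • e.symm (EuclideanSpace.single 0 1) + p.2 • e.symm (EuclideanSpace.single 1 1) := rfl

@[simp] theorem frameMap_coord_zero (p : ℝ × ℝ) : (e (frameMap e p)) 0 = p.1 := by
  simp [frameMap_apply]

@[simp] theorem frameMap_coord_one (p : ℝ × ℝ) : (e (frameMap e p)) 1 = p.2 := by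
  simp [frameMap_apply]

theorem frameMap_coords (z : Plane) : frameMap e ((e z) 0, (e z) 1) = z := by
  apply e.injective
  ext i
  fin_cases i
  · exact frameMap_coord_zero e _
  · exact frameMap_coord_one e _

theorem inner_eq_coords (z w : Plane) :
    inner ℝ z w = (e z) 0 * (e w) 0 + (e z) 1 * (e w) 1 := by
  rw [← e.inner_map_map z w, PiLp.inner_apply, Fin.sum_univ_two]
  simp [mul_comm]

theorem norm_sq_eq_coords (z : Plane) : ‖z‖ ^ 2 = (e z) 0 ^ 2 + (e z) 1 ^ 2 := by
  rw [← real_inner_self_eq_norm_sq, inner_eq_coords e]; ring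

theorem abs_coord_le_norm (z : Plane) (i : Fin 2) : |(e z) i| ≤ ‖z‖ := by
  rw [← e.norm_map z]
  exact PiLp.norm_apply_le (e z) i

theorem norm_frameMap (p : ℝ × ℝ) : ‖frameMap e p‖ = √(p.1 ^ 2 + p.2 ^ 2) := by
  rw [eq_comm, Real.sqrt_eq_iff_mul_self_eq (by positivity) (norm_nonneg _), ← sq,
    norm_sq_eq_coords e]
  simp

/-- Cartesian coordinates as a homeomorphism. -/
noncomputable def frameHomeomorph : ℝ × ℝ ≃ₜ Plane where
  toFun := frameMap e
  invFun z := ((e z) 0, (e z) 1)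
  left_inv p := by simp
  right_inv z := frameMap_coords e z
  continuous_toFun := (frameMap e).continuous
  continuous_invFun := by fun_prop

theorem measurePreserving_frameMap : MeasurePreserving (frameMap e) := by
  have h1 := (volume_preserving_finTwoArrow ℝ).symm
  have h2 := PiLp.volume_preserving_toLp (Fin 2)
  have h3 := (e.symm.measurePreserving).comp (h2.comp h1)
  have heq : ⇑(frameMap e) = e.symm ∘ WithLp.toLp 2 ∘ MeasurableEquiv.finTwoArrow.symm := by
    funext p
    apply e.injective
    ext i
    fin_cases i
    · simp
    · simp
  rw [heq]
  exact h3

/-- The graph of `g` as a parametrized curve. -/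
noncomputable def graphCurve (g : ℝ → ℝ) (x : ℝ) : Plane := frameMap e (x, g x)

/-- The upward unit normal of the graph of `g`. -/
noncomputable def graphNormal (g : ℝ → ℝ) (x : ℝ) : Plane :=
  (√(1 + deriv g x ^ 2))⁻¹ • frameMap e (-deriv g x, 1)

variable {g : ℝ → ℝ} {K : ℝ≥0}

theorem lipschitzWith_graphCurve (hg : LipschitzWith K g) :
    LipschitzWith (‖frameMap e‖₊ * max 1 K) (graphCurve e g) :=
  (frameMap e).lipschitz.comp (LipschitzWith.id.prodMk hg)

theorem graphCurve_injective : Function.Injective (graphCurve e g) := by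
  intro x y h
  have := congrArg (fun z => (e z) 0) h
  simpa [graphCurve] using this

theorem measurableEmbedding_graphCurve (hg : LipschitzWith K g) :
    MeasurableEmbedding (graphCurve e g) :=
  (lipschitzWith_graphCurve e hg).continuous.measurableEmbedding (graphCurve_injective e)

theorem hasDerivAt_graphCurve {x : ℝ} (hx : DifferentiableAt ℝ g x) :
    HasDerivAt (graphCurve e g) (frameMap e (1, deriv g x)) x :=
  (frameMap e).hasFDerivAt.comp_hasDerivAt x ((hasDerivAt_id x).prodMk hx.hasDerivAt)

theorem norm_deriv_graphCurve {x : ℝ} (hx : DifferentiableAt ℝ g x) :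
    ‖deriv (graphCurve e g) x‖ = √(1 + deriv g x ^ 2) := by
  rw [(hasDerivAt_graphCurve e hx).deriv, norm_frameMap, one_pow]

/-- In the ball with centre `p` and radius `r`, the set `Ω` is the region below the graph of the
Lipschitz function `g`, in the coordinates `e`. -/
structure IsGraphChart (Ω : Set Plane) (p : Plane) (g : ℝ → ℝ) (K : ℝ≥0) (r : ℝ) : Prop where
  pos : 0 < r
  lipschitz : LipschitzWith K g
  mem_iff : ∀ z ∈ Metric.ball p r, z ∈ Ω ↔ (e z) 1 < g ((e z) 0)

variable {e} {Ω : Set Plane} {p : Plane} {r : ℝ}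

/-- Points strictly above the graph have a neighbourhood missing `Ω`, while points of the graph are
limits of points vertically below them. -/
theorem IsGraphChart.mem_frontier_iff (h : IsGraphChart e Ω p g K r) (hΩ : IsOpen Ω) {z : Plane}
    (hz : z ∈ Metric.ball p r) : z ∈ frontier Ω ↔ (e z) 1 = g ((e z) 0) := by
  have hgc := h.lipschitz.continuous
  rw [hΩ.frontier_eq, Set.mem_sdiff, h.mem_iff z hz, not_lt]
  constructor
  · rintro ⟨hcl, hle⟩
    by_contra hne
    have hlt : g ((e z) 0) < (e z) 1 := lt_of_le_of_ne hle (Ne.symm hne)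
    have hopen : IsOpen {w : Plane | g ((e w) 0) < (e w) 1} :=
      isOpen_lt (by fun_prop) (by fun_prop)
    obtain ⟨w, ⟨hw1, hw2⟩, hw3⟩ := mem_closure_iff.1 hcl _ (hopen.inter Metric.isOpen_ball)
      ⟨hlt, hz⟩
    exact absurd ((h.mem_iff w hw2).1 hw3) (not_lt.2 (le_of_lt hw1))
  · intro heq
    refine ⟨?_, heq.ge⟩
    have ht : Tendsto (fun t : ℝ => z - frameMap e (0, t)) (𝓝[>] 0) (𝓝 z) := by
      have hc : Continuous fun t : ℝ => z - frameMap e (0, t) := by fun_prop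
      have := hc.tendsto 0
      simp only [Prod.mk_zero_zero, map_zero, sub_zero] at this
      exact this.mono_left nhdsWithin_le_nhds
    refine mem_closure_of_tendsto ht ?_
    filter_upwards [ht (Metric.isOpen_ball.mem_nhds hz), self_mem_nhdsWithin] with t ht1 ht2
    rw [h.mem_iff _ ht1]
    simp only [map_sub, PiLp.sub_apply, frameMap_coord_zero, frameMap_coord_one, sub_zero]
    have : (0 : ℝ) < t := ht2
    linarith

theorem IsGraphChart.graphCurve_mem_frontier (h : IsGraphChart e Ω p g K r) (hΩ : IsOpen Ω)
    {x : ℝ} (hx : graphCurve e g x ∈ Metric.ball p r) : graphCurve e g x ∈ frontier Ω := by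
  rw [h.mem_frontier_iff hΩ hx]
  simp [graphCurve]

theorem IsGraphChart.eq_graphCurve (h : IsGraphChart e Ω p g K r) (hΩ : IsOpen Ω)
    {z : Plane} (hz : z ∈ Metric.ball p r) (hf : z ∈ frontier Ω) :
    z = graphCurve e g ((e z) 0) := by
  rw [h.mem_frontier_iff hΩ hz] at hf
  rw [graphCurve, ← hf, frameMap_coords]

/-- Leaving `x` in the direction `ν' - ν` would enter `Ω` according to `ν` and avoid it according to
`ν'`. -/
theorem IsOutwardNormal.unique {Ω : Set Plane} {x ν ν' : Plane} (h : IsOutwardNormal Ω x ν)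
    (h' : IsOutwardNormal Ω x ν') : ν = ν' := by
  by_contra hne
  set d := ν' - ν with hd
  have hd0 : 0 < ‖d‖ := norm_pos_iff.2 (sub_ne_zero.2 (Ne.symm hne))
  have hsq : ‖d‖ ^ 2 = 2 - 2 * inner ℝ ν ν' := by
    rw [hd, norm_sub_sq_real, h.1, h'.1, real_inner_comm]; ring
  have e1 : inner ℝ d ν = -(‖d‖ ^ 2 / 2) := by
    rw [hsq, hd, inner_sub_left, real_inner_self_eq_norm_sq, h.1, real_inner_comm]; ring
  have e2 : inner ℝ d ν' = ‖d‖ ^ 2 / 2 := by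
    rw [hsq, hd, inner_sub_left, real_inner_self_eq_norm_sq, h'.1]; ring
  have ht : Tendsto (fun t : ℝ => x + t • d) (𝓝[>] 0) (𝓝 x) := by
    have hc : Continuous fun t : ℝ => x + t • d := by fun_prop
    have := hc.tendsto 0
    simp only [zero_smul, add_zero] at this
    exact this.mono_left nhdsWithin_le_nhds
  -- Along `d` the inner products with `ν` and `ν'` are `∓‖d‖ / 2` per unit length, so half of that
  -- is a safe aperture.
  have hε : 0 < ‖d‖ / 4 := by positivity
  obtain ⟨t, ⟨h1, h2⟩, ht0⟩ := ((ht.eventually (h.2 _ hε)).and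
    (ht.eventually (h'.2 _ hε)) |>.and self_mem_nhdsWithin).exists
  have ht0 : (0 : ℝ) < t := ht0
  have key : ‖d‖ / 4 * (t * ‖d‖) < t * (‖d‖ ^ 2 / 2) := by
    have : 0 < t * ‖d‖ ^ 2 := by positivity
    nlinarith
  rw [add_sub_cancel_left, norm_smul, Real.norm_eq_abs, abs_of_pos ht0, inner_smul_left, e1] at h1
  rw [add_sub_cancel_left, norm_smul, Real.norm_eq_abs, abs_of_pos ht0, inner_smul_left, e2] at h2
  refine h2.2 (by simpa using key) (h1.1 ?_)
  have : -(‖d‖ / 4) * (t * ‖d‖) = -(‖d‖ / 4 * (t * ‖d‖)) := by ring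
  rw [this]
  simpa using key

theorem IsOutwardNormal.outwardNormal_eq {Ω : Set Plane} {x ν : Plane}
    (h : IsOutwardNormal Ω x ν) : outwardNormal Ω x = ν := by
  have hx : ∃ ν, IsOutwardNormal Ω x ν := ⟨ν, h⟩
  rw [outwardNormal, dif_pos hx]
  exact hx.choose_spec.unique h

/-- Near a point of differentiability the graph deviates from its tangent by at most `ε` times the
horizontal distance, which keeps it inside the double cone of aperture `ε` around the tangent. -/
theorem IsGraphChart.outwardNormal_graphCurve (h : IsGraphChart e Ω p g K r) {x : ℝ}
    (hx : graphCurve e g x ∈ Metric.ball p r) (hd : DifferentiableAt ℝ g x) :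
    outwardNormal Ω (graphCurve e g x) = graphNormal e g x := by
  apply IsOutwardNormal.outwardNormal_eq
  set m := deriv g x with hm
  have hL1 : 1 ≤ √(1 + m ^ 2) := by
    rw [Real.one_le_sqrt]; nlinarith [sq_nonneg m]
  have hL0 : 0 < √(1 + m ^ 2) := by linarith
  refine ⟨?_, fun ε hε => ?_⟩
  · rw [graphNormal, ← hm, norm_smul, norm_inv, Real.norm_eq_abs, abs_of_pos hL0, norm_frameMap]
    simp only [even_two, Even.neg_pow, one_pow]
    rw [add_comm (m ^ 2), inv_mul_cancel₀ hL0.ne']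
  have h1 : ∀ᶠ ξ in 𝓝 x, |g ξ - g x - m * (ξ - x)| ≤ ε * |ξ - x| := by
    have := hd.hasDerivAt.isLittleO.def hε
    simpa [hm, mul_comm] using this
  have hc : Tendsto (fun z : Plane => (e z) 0) (𝓝 (graphCurve e g x)) (𝓝 x) := by
    have hcont : Continuous fun z : Plane => (e z) 0 := by fun_prop
    have := hcont.tendsto (graphCurve e g x)
    rwa [show (e (graphCurve e g x)) 0 = x by simp [graphCurve]] at this
  filter_upwards [hc.eventually h1, Metric.isOpen_ball.mem_nhds hx] with z hz hzb
  set w := z - graphCurve e g x with hw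
  have hw0 : (e w) 0 = (e z) 0 - x := by simp [hw, graphCurve]
  have hw1 : (e w) 1 = (e z) 1 - g x := by simp [hw, graphCurve]
  have hin : inner ℝ w (graphNormal e g x) =
      (√(1 + m ^ 2))⁻¹ * ((e w) 1 - m * (e w) 0) := by
    rw [graphNormal, ← hm, inner_smul_right, inner_eq_coords e, frameMap_coord_zero,
      frameMap_coord_one]
    ring
  have hwn : |(e w) 0| ≤ √(1 + m ^ 2) * ‖w‖ :=
    (abs_coord_le_norm e w 0).trans (le_mul_of_one_le_left (norm_nonneg _) hL1)
  rw [h.mem_iff z hzb, hin, inv_mul_eq_div]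
  rw [← hw0] at hz
  have hz1 : g ((e z) 0) - g x - m * (e w) 0 ≤ ε * (√(1 + m ^ 2) * ‖w‖) :=
    (le_abs_self _).trans (hz.trans (by gcongr))
  have hz2 : -(ε * (√(1 + m ^ 2) * ‖w‖)) ≤ g ((e z) 0) - g x - m * (e w) 0 :=
    neg_le_of_abs_le (hz.trans (by gcongr))
  constructor
  · intro hlt
    rw [div_lt_iff₀ hL0] at hlt
    nlinarith
  · intro hlt
    rw [lt_div_iff₀ hL0] at hlt
    rw [not_lt]
    nlinarith

end Chart

/-! ### The boundary of a Lipschitz domain -/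

section Boundary

open scoped ENNReal

theorem IsLipschitzDomain.exists_isGraphChart {Ω : Set Plane} (hΩ : IsLipschitzDomain Ω)
    {p : Plane} (hp : p ∈ frontier Ω) :
    ∃ (e : Plane ≃ₗᵢ[ℝ] Plane) (g : ℝ → ℝ) (K : ℝ≥0) (r : ℝ), IsGraphChart e Ω p g K r := by
  obtain ⟨e, g, K, r, hr, hg, h⟩ := hΩ.boundary p hp
  exact ⟨e, g, K, r, hr, hg, h⟩

theorem IsLipschitzDomain.isCompact_frontier {Ω : Set Plane} (hΩ : IsLipschitzDomain Ω) :
    IsCompact (frontier Ω) :=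
  Metric.isCompact_of_isClosed_isBounded isClosed_frontier
    (hΩ.bounded.closure.subset frontier_subset_closure)

theorem norm_outwardNormal_le (Ω : Set Plane) (x : Plane) : ‖outwardNormal Ω x‖ ≤ 1 := by
  unfold outwardNormal
  split_ifs with h
  · exact h.choose_spec.1.le
  · simp

variable {e : Plane ≃ₗᵢ[ℝ] Plane} {Ω : Set Plane} {p : Plane} {g : ℝ → ℝ} {K : ℝ≥0} {r : ℝ}

theorem IsGraphChart.hausdorffMeasure_lt_top (h : IsGraphChart e Ω p g K r) (hΩ : IsOpen Ω) :
    μH[1] (frontier Ω ∩ Metric.ball p r) < ∞ := by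
  refine lt_of_le_of_lt (measure_mono ?_) (hausdorffMeasure_image_Icc_lt_top
    (lipschitzWith_graphCurve e h.lipschitz) ((e p) 0 - r) ((e p) 0 + r))
  rintro z ⟨hz, hzb⟩
  refine ⟨(e z) 0, ?_, (h.eq_graphCurve hΩ hzb hz).symm⟩
  rw [mem_ball_iff_norm] at hzb
  have h1 := (abs_coord_le_norm e (z - p) 0).trans hzb.le
  rw [map_sub, PiLp.sub_apply, abs_le] at h1
  constructor <;> linarith [h1.1, h1.2]

theorem measurable_graphNormal (e : Plane ≃ₗᵢ[ℝ] Plane) (g : ℝ → ℝ) :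
    Measurable (graphNormal e g) := by
  unfold graphNormal
  have hd := measurable_deriv g
  have h1 : Measurable fun x => (√(1 + deriv g x ^ 2))⁻¹ :=
    ((measurable_const.add (hd.pow_const 2)).sqrt).inv
  have h2 : Measurable fun x => frameMap e (-deriv g x, 1) :=
    (frameMap e).continuous.measurable.comp (hd.neg.prodMk measurable_const)
  exact h1.smul h2

/-- The normal agrees with the measurable `graphNormal` except over the points where `g` is not
differentiable, and the Lipschitz graph map sends this null set to a null set. -/
theorem IsGraphChart.aemeasurable_outwardNormal (h : IsGraphChart e Ω p g K r) (hΩ : IsOpen Ω) :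
    AEMeasurable (outwardNormal Ω) (μH[1].restrict (frontier Ω ∩ Metric.ball p r)) := by
  have hcoord : Measurable fun z : Plane => (e z) 0 := by
    have : Continuous fun z : Plane => (e z) 0 := by fun_prop
    exact this.measurable
  refine ⟨fun z => graphNormal e g ((e z) 0), (measurable_graphNormal e g).comp hcoord, ?_⟩
  have hnull : μH[1] (graphCurve e g '' {x | ¬ DifferentiableAt ℝ g x}) = 0 := by
    have h1 : volume {x | ¬ DifferentiableAt ℝ g x} = 0 := h.lipschitz.ae_differentiableAt_of_real
    have h2 := ((lipschitzWith_graphCurve e h.lipschitz).lipschitzOnWith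
      (s := {x | ¬ DifferentiableAt ℝ g x})).hausdorffMeasure_image_le (d := 1) zero_le_one
    rw [hausdorffMeasure_real, h1, mul_zero] at h2
    exact le_antisymm h2 bot_le
  have hS : MeasurableSet (frontier Ω ∩ Metric.ball p r) :=
    isClosed_frontier.measurableSet.inter measurableSet_ball
  rw [Filter.EventuallyEq, ae_restrict_iff' hS]
  filter_upwards [compl_mem_ae_iff.2 hnull] with z hz hzS
  have hzg := h.eq_graphCurve hΩ hzS.2 hzS.1
  have hd : DifferentiableAt ℝ g ((e z) 0) := by
    by_contra hnd
    exact hz ⟨(e z) 0, hnd, hzg.symm⟩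
  have := h.outwardNormal_graphCurve (x := (e z) 0) (by rw [← hzg]; exact hzS.2) hd
  rwa [← hzg] at this

theorem IsLipschitzDomain.boundary_measure (hΩ : IsLipschitzDomain Ω) :
    μH[1] (frontier Ω) < ∞ ∧ AEMeasurable (outwardNormal Ω) (μH[1].restrict (frontier Ω)) := by
  refine hΩ.isCompact_frontier.induction_on
    (p := fun s => μH[1] s < ∞ ∧ AEMeasurable (outwardNormal Ω) (μH[1].restrict s)) ?_ ?_ ?_ ?_
  · simp
  · exact fun s t hst h => ⟨(measure_mono hst).trans_lt h.1, h.2.mono_set hst⟩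
  · exact fun s t hs ht => ⟨(measure_union_le s t).trans_lt (ENNReal.add_lt_top.2 ⟨hs.1, ht.1⟩),
      aemeasurable_union_iff.2 ⟨hs.2, ht.2⟩⟩
  · intro p hp
    obtain ⟨e, g, K, r, h⟩ := hΩ.exists_isGraphChart hp
    exact ⟨frontier Ω ∩ Metric.ball p r,
      inter_mem self_mem_nhdsWithin (mem_nhdsWithin_of_mem_nhds (Metric.ball_mem_nhds p h.pos)),
      h.hausdorffMeasure_lt_top hΩ.isOpen, h.aemeasurable_outwardNormal hΩ.isOpen⟩

/-- The inward flux density `(G · n)⁻` through the boundary. -/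
noncomputable def inwardFlux (Ω : Set Plane) (G : Plane → Plane) (z : Plane) : ℝ :=
  max (-inner ℝ (G z) (outwardNormal Ω z)) 0

theorem inwardFlux_nonneg (Ω : Set Plane) (G : Plane → Plane) (z : Plane) :
    0 ≤ inwardFlux Ω G z := le_max_right _ _

/-- Homogeneity for nonnegative factors: it lets the negative part pass through a partition of unity
and through the factor `u²`. -/
theorem inwardFlux_smul {Ω : Set Plane} {G : Plane → Plane} {c : ℝ} {z : Plane} (hc : 0 ≤ c) :
    max (-inner ℝ (c • G z) (outwardNormal Ω z)) 0 = c * inwardFlux Ω G z := by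
  rw [inwardFlux, real_inner_smul_left, mul_max_of_nonneg _ _ hc, mul_zero, mul_neg]

theorem IsLipschitzDomain.integrable_inwardFlux (hΩ : IsLipschitzDomain Ω) {G : Plane → Plane}
    (hG : Continuous G) : Integrable (inwardFlux Ω G) (μH[1].restrict (frontier Ω)) := by
  obtain ⟨C, hC⟩ := hΩ.isCompact_frontier.exists_bound_of_continuousOn hG.continuousOn
  refine IntegrableOn.of_bound hΩ.boundary_measure.1 ?_ C ?_
  · have h1 := hG.measurable.aemeasurable (μ := μH[1].restrict (frontier Ω))
    exact ((h1.inner hΩ.boundary_measure.2).neg.max aemeasurable_const).aestronglyMeasurable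
  · rw [ae_restrict_iff' isClosed_frontier.measurableSet]
    refine Eventually.of_forall fun z hz => ?_
    rw [Real.norm_eq_abs, abs_of_nonneg (inwardFlux_nonneg _ _ _)]
    refine max_le ?_ ((norm_nonneg _).trans (hC z hz))
    calc -inner ℝ (G z) (outwardNormal Ω z) ≤ |inner ℝ (G z) (outwardNormal Ω z)| := neg_le_abs _
      _ ≤ ‖G z‖ * ‖outwardNormal Ω z‖ := abs_real_inner_le_norm _ _
      _ ≤ C * 1 := mul_le_mul (hC z hz) (norm_outwardNormal_le Ω z) (norm_nonneg _)
          ((norm_nonneg _).trans (hC z hz))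
      _ = C := mul_one C

/-- Arc length along a graph, as a measure in the plane. -/
noncomputable def graphMeasure (e : Plane ≃ₗᵢ[ℝ] Plane) (g : ℝ → ℝ) : Measure Plane :=
  (volume.withDensity fun x => ENNReal.ofReal √(1 + deriv g x ^ 2)).map (graphCurve e g)

/-- This one-sided comparison suffices because only integrals of the nonnegative inward flux are
transferred from arc length to Hausdorff measure. -/
theorem IsGraphChart.graphMeasure_restrict_le (h : IsGraphChart e Ω p g K r) (hΩ : IsOpen Ω) :
    (graphMeasure e g).restrict (Metric.ball p r) ≤ μH[1].restrict (frontier Ω) := by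
  have hemb := measurableEmbedding_graphCurve e h.lipschitz
  have hd : ∀ᵐ x, DifferentiableAt ℝ g x := h.lipschitz.ae_differentiableAt_of_real
  have hle := withDensity_norm_deriv_le_comap_hausdorffMeasure
    (lipschitzWith_graphCurve e h.lipschitz) hemb
    (hd.mono fun x hx => (hasDerivAt_graphCurve e hx).differentiableAt)
  have hcongr : volume.withDensity (fun x => ENNReal.ofReal ‖deriv (graphCurve e g) x‖) =
      volume.withDensity fun x => ENNReal.ofReal √(1 + deriv g x ^ 2) :=
    withDensity_congr_ae (hd.mono fun x hx => by simp only [norm_deriv_graphCurve e hx])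
  rw [hcongr] at hle
  rw [Measure.le_iff]
  intro B hB
  rw [Measure.restrict_apply hB, Measure.restrict_apply hB, graphMeasure, hemb.map_apply]
  refine (hle _).trans ?_
  rw [hemb.comap_apply]
  refine measure_mono ?_
  rintro _ ⟨x, hx, rfl⟩
  exact ⟨hx.1, h.graphCurve_mem_frontier hΩ hx.2⟩

/-- The divergence is a trace, hence the same in every orthonormal frame. -/
theorem divergence_eq_frame (e : Plane ≃ₗᵢ[ℝ] Plane) (W : Plane → Plane) (y : Plane) :
    divergence W y = (e (fderiv ℝ W y (frameMap e (1, 0)))) 0 +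
      (e (fderiv ℝ W y (frameMap e (0, 1)))) 1 := by
  set b := EuclideanSpace.basisFun (Fin 2) ℝ
  have h1 := LinearMap.trace_eq_sum_inner (fderiv ℝ W y : Plane →ₗ[ℝ] Plane) b
  have h2 := LinearMap.trace_eq_sum_inner (fderiv ℝ W y : Plane →ₗ[ℝ] Plane) (b.map e.symm)
  rw [h1] at h2
  have h3 : divergence W y = ∑ i, inner ℝ (b i) (fderiv ℝ W y (b i)) := by
    simp [divergence, b, EuclideanSpace.inner_single_left]
  rw [h3]
  refine h2.trans ?_
  rw [Fin.sum_univ_two]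
  simp only [OrthonormalBasis.map_apply, ContinuousLinearMap.coe_coe]
  simp only [← e.inner_map_map (e.symm _), e.apply_symm_apply]
  simp [b, EuclideanSpace.inner_single_left, frameMap_apply]

theorem divergence_eq_zero_of_notMem_tsupport {H : Plane → Plane} {z : Plane}
    (hz : z ∉ tsupport H) : divergence H z = 0 := by
  have h : fderiv ℝ H z = 0 := by
    by_contra hne
    exact hz (support_fderiv_subset ℝ hne)
  simp [divergence, h]

theorem continuous_divergence {H : Plane → Plane} (hH : ContDiff ℝ 1 H) :
    Continuous (divergence H) := by
  have := hH.continuous_fderiv (by simp)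
  unfold divergence
  fun_prop

/-- Integration of the divergence over the region below the graph. -/
theorem IsGraphChart.integral_divergence (h : IsGraphChart e Ω p g K r) (hΩ : IsOpen Ω)
    {H : Plane → Plane} (hH : ContDiff ℝ 1 H) (hc : HasCompactSupport H)
    (hs : tsupport H ⊆ Metric.ball p r) :
    ∫ z in Ω, divergence H z =
      -(∫ x, deriv g x * (e (H (graphCurve e g x))) 0) + ∫ x, (e (H (graphCurve e g x))) 1 := by
  set D : Set Plane := {z | (e z) 1 < g ((e z) 0)} with hD
  have hDm : MeasurableSet D := by
    have h1 : Continuous fun z : Plane => (e z) 0 := by fun_prop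
    exact (isOpen_lt (by fun_prop) (h.lipschitz.continuous.comp h1)).measurableSet
  have h1 : ∫ z in Ω, divergence H z = ∫ z in D, divergence H z := by
    rw [← integral_indicator hΩ.measurableSet, ← integral_indicator hDm]
    congr 1
    ext z
    by_cases hz : z ∈ Metric.ball p r
    · by_cases hzΩ : z ∈ Ω
      · rw [indicator_of_mem hzΩ, indicator_of_mem (show z ∈ D from (h.mem_iff z hz).1 hzΩ)]
      · rw [indicator_of_notMem hzΩ, 
          indicator_of_notMem (show z ∉ D from fun hzD => hzΩ ((h.mem_iff z hz).2 hzD))]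
    · have h0 := divergence_eq_zero_of_notMem_tsupport (H := H) (z := z) (fun hzt => hz (hs hzt))
      simp [indicator, h0]
  have hCD : ∀ i : Fin 2, ContDiff ℝ 1 fun q : ℝ × ℝ => (e (H (frameMap e q))) i := by
    intro i
    have h1 : ContDiff ℝ 1 fun q : ℝ × ℝ => e (H (frameMap e q)) :=
      e.contDiff.comp (hH.comp (frameMap e).contDiff)
    exact (contDiff_euclidean.1 h1) i
  have hCS : ∀ i : Fin 2, HasCompactSupport fun q : ℝ × ℝ => (e (H (frameMap e q))) i := by
    intro i
    have h1 : HasCompactSupport (H ∘ frameHomeomorph e) := hc.comp_homeomorph _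
    exact h1.comp_left (g := fun w : Plane => (e w) i) (by simp)
  have hfd : ∀ (i : Fin 2) (q v : ℝ × ℝ), fderiv ℝ (fun q : ℝ × ℝ => (e (H (frameMap e q))) i) q v
      = (e (fderiv ℝ H (frameMap e q) (frameMap e v))) i := by
    intro i q v
    have h1 := ((hH.differentiable (by simp)) (frameMap e q)).hasFDerivAt.comp q
      (frameMap e).hasFDerivAt
    have h2 := ((EuclideanSpace.proj (𝕜 := ℝ) i).comp
      (e : Plane →L[ℝ] Plane)).hasFDerivAt.comp q h1
    have h3 : (fun q : ℝ × ℝ => (e (H (frameMap e q))) i) =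
      ((EuclideanSpace.proj (𝕜 := ℝ) i).comp (e : Plane →L[ℝ] Plane)) ∘ H ∘ frameMap e := rfl
    rw [h3, h2.fderiv]
    rfl
  have hpre : frameMap e ⁻¹' D = {q : ℝ × ℝ | q.2 < g q.1} := by
    ext q; simp [hD]
  have hemb : MeasurableEmbedding (frameMap e) := (frameHomeomorph e).measurableEmbedding
  rw [h1, ← (measurePreserving_frameMap e).setIntegral_preimage_emb hemb, hpre]
  have hi : ∀ (i : Fin 2) (v : ℝ × ℝ), IntegrableOn
      (fun q : ℝ × ℝ => fderiv ℝ (fun q : ℝ × ℝ => (e (H (frameMap e q))) i) q v)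
      {q : ℝ × ℝ | q.2 < g q.1} := fun i v =>
    ((((hCD i).continuous_fderiv (by simp)).clm_apply
      continuous_const).integrable_of_hasCompactSupport ((hCS i).fderiv_apply ℝ v)).integrableOn
  calc ∫ q in {q : ℝ × ℝ | q.2 < g q.1}, divergence H (frameMap e q)
      = ∫ q in {q : ℝ × ℝ | q.2 < g q.1},
        (fderiv ℝ (fun q : ℝ × ℝ => (e (H (frameMap e q))) 0) q (1, 0) +
         fderiv ℝ (fun q : ℝ × ℝ => (e (H (frameMap e q))) 1) q (0, 1)) := by
        simp_rw [hfd, divergence_eq_frame e]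
    _ = _ := by
      rw [integral_add (hi 0 _) (hi 1 _), setIntegral_subgraph_fderiv_fst (hCD 0) (hCS 0)
        h.lipschitz, setIntegral_subgraph_fderiv_snd (hCD 1) (hCS 1) h.lipschitz]
      rfl

/-- On the graph the integrand of `integral_divergence`, with its sign reversed, equals `√(1 + g'²)`
times `-H · n`. It is bounded by the inward flux times the arc length element. -/
theorem IsGraphChart.neg_integral_divergence_le (h : IsGraphChart e Ω p g K r)
    (hΩ : IsLipschitzDomain Ω) {H : Plane → Plane} (hH : ContDiff ℝ 1 H)
    (hc : HasCompactSupport H) (hs : tsupport H ⊆ Metric.ball p r) :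
    -∫ z in Ω, divergence H z ≤ ∫ z in frontier Ω, inwardFlux Ω H z ∂μH[1] := by
  have hemb := measurableEmbedding_graphCurve e h.lipschitz
  have hle := h.graphMeasure_restrict_le hΩ.isOpen
  have hint := hΩ.integrable_inwardFlux hH.continuous
  have hzero : ∀ z, z ∉ Metric.ball p r → inwardFlux Ω H z = 0 := by
    intro z hz
    have : H z = 0 := image_eq_zero_of_notMem_tsupport fun hzt => hz (hs hzt)
    simp [inwardFlux, this]
  have hmeas : Measurable fun x => ENNReal.ofReal √(1 + deriv g x ^ 2) :=
    (measurable_const.add ((measurable_deriv g).pow_const 2)).sqrt.ennreal_ofReal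
  have hI : Integrable (inwardFlux Ω H) (graphMeasure e g) := by
    have h1 : IntegrableOn (inwardFlux Ω H) (Metric.ball p r) (graphMeasure e g) :=
      hint.mono_measure hle
    exact h1.integrable_of_forall_notMem_eq_zero hzero
  have hI' : Integrable (fun x => √(1 + deriv g x ^ 2) * inwardFlux Ω H (graphCurve e g x)) := by
    rw [graphMeasure, hemb.integrable_map_iff, integrable_withDensity_iff_integrable_smul' hmeas
      (Eventually.of_forall fun _ => ENNReal.ofReal_lt_top)] at hI
    refine hI.congr (Eventually.of_forall fun x => ?_)
    simp only [Function.comp_apply, smul_eq_mul]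
    rw [ENNReal.toReal_ofReal (Real.sqrt_nonneg _)]
  have hE : ∫ x, √(1 + deriv g x ^ 2) * inwardFlux Ω H (graphCurve e g x) =
      ∫ z, inwardFlux Ω H z ∂(graphMeasure e g) := by
    rw [graphMeasure, hemb.integral_map, integral_withDensity_eq_integral_toReal_smul hmeas
      (Eventually.of_forall fun _ => ENNReal.ofReal_lt_top)]
    refine integral_congr_ae (Eventually.of_forall fun x => ?_)
    simp only [smul_eq_mul]
    rw [ENNReal.toReal_ofReal (Real.sqrt_nonneg _)]
  have hfin : ∫ x, √(1 + deriv g x ^ 2) * inwardFlux Ω H (graphCurve e g x) ≤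
      ∫ z in frontier Ω, inwardFlux Ω H z ∂μH[1] := by
    rw [hE, ← setIntegral_eq_integral_of_forall_compl_eq_zero hzero]
    exact integral_mono_measure hle (Eventually.of_forall fun z => inwardFlux_nonneg _ _ _) hint
  refine le_trans ?_ hfin
  have hcomp : Continuous fun x => H (graphCurve e g x) :=
    hH.continuous.comp (lipschitzWith_graphCurve e h.lipschitz).continuous
  have hcs : HasCompactSupport fun x => H (graphCurve e g x) := by
    refine HasCompactSupport.of_support_subset_isCompact
      (hc.isCompact.image (f := fun z : Plane => (e z) 0) (by fun_prop)) ?_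
    intro x hx
    exact ⟨graphCurve e g x, subset_tsupport _ hx, by simp [graphCurve]⟩
  have hi : ∀ i : Fin 2, Integrable fun x => (e (H (graphCurve e g x))) i := by
    intro i
    have h1 : Continuous fun w : Plane => (e w) i := by fun_prop
    have h2 : HasCompactSupport fun x => (e (H (graphCurve e g x))) i :=
      hcs.comp_left (g := fun w : Plane => (e w) i) (by simp)
    exact (h1.comp hcomp).integrable_of_hasCompactSupport h2
  have hi0 : Integrable fun x => deriv g x * (e (H (graphCurve e g x))) 0 :=
    (hi 0).bdd_mul (c := K) (measurable_deriv g).aestronglyMeasurable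
      (Eventually.of_forall fun x => norm_deriv_le_of_lipschitz h.lipschitz)
  rw [h.integral_divergence hΩ.isOpen hH hc hs, neg_add, neg_neg, ← sub_eq_add_neg,
    ← integral_sub hi0 (hi 1)]
  refine integral_mono_ae (hi0.sub (hi 1)) hI' ?_
  have hd : ∀ᵐ x, DifferentiableAt ℝ g x := h.lipschitz.ae_differentiableAt_of_real
  filter_upwards [hd] with x hx
  by_cases hxb : graphCurve e g x ∈ Metric.ball p r
  · have hL0 : 0 < √(1 + deriv g x ^ 2) := Real.sqrt_pos.2 (by positivity)
    have h1 : -inner ℝ (H (graphCurve e g x)) (outwardNormal Ω (graphCurve e g x)) =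
        (√(1 + deriv g x ^ 2))⁻¹ * (deriv g x * (e (H (graphCurve e g x))) 0 -
          (e (H (graphCurve e g x))) 1) := by
      rw [h.outwardNormal_graphCurve hxb hx, graphNormal, inner_smul_right, inner_eq_coords e,
        frameMap_coord_zero, frameMap_coord_one]
      ring
    have h2 : (√(1 + deriv g x ^ 2))⁻¹ * (deriv g x * (e (H (graphCurve e g x))) 0 -
          (e (H (graphCurve e g x))) 1) ≤ inwardFlux Ω H (graphCurve e g x) := by
      rw [← h1]; exact le_max_left _ _
    rwa [inv_mul_le_iff₀ hL0] at h2
  · have : H (graphCurve e g x) = 0 :=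
      image_eq_zero_of_notMem_tsupport fun hzt => hxb (hs hzt)
    simp only [this, map_zero, PiLp.zero_apply, mul_zero, sub_self]
    exact mul_nonneg (Real.sqrt_nonneg _) (inwardFlux_nonneg _ _ _)

end Boundary

/-! ### The divergence theorem as an inequality -/

section Divergence

open scoped Manifold ContDiff

theorem integral_divergence_eq_zero {H : Plane → Plane} (hH : ContDiff ℝ 1 H)
    (hc : HasCompactSupport H) : ∫ z, divergence H z = 0 := by
  have hCD : ∀ i : Fin 2, ContDiff ℝ 1 fun z => H z i := fun i => (contDiff_euclidean.1 hH) i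
  have hCS : ∀ i : Fin 2, HasCompactSupport fun z => H z i := fun i =>
    hc.comp_left (g := fun w : Plane => w i) (by simp)
  have hfd : ∀ (i : Fin 2) (z v : Plane), fderiv ℝ (fun z => H z i) z v =
      (fderiv ℝ H z v) i := by
    intro i z v
    have h2 := (EuclideanSpace.proj (𝕜 := ℝ) i).hasFDerivAt.comp z
      ((hH.differentiable (by simp)) z).hasFDerivAt
    have h3 : (fun z => H z i) = (EuclideanSpace.proj (𝕜 := ℝ) i) ∘ H := rfl
    rw [h3, h2.fderiv]
    rfl
  have hzero : ∀ (i : Fin 2) (v : Plane), ∫ z, fderiv ℝ (fun z => H z i) z v = 0 := by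
    intro i v
    obtain ⟨C, hC⟩ := (hCD i).lipschitzWith_of_hasCompactSupport (hCS i) (by simp)
    have h := LipschitzWith.integral_lineDeriv_mul_eq (μ := volume)
      (LipschitzWith.const (1 : ℝ) : LipschitzWith 0 fun _ : Plane => (1 : ℝ)) hC (hCS i) (-v)
    simp only [neg_neg, mul_one] at h
    have h1 : ∀ z, lineDeriv ℝ (fun z => H z i) z v = fderiv ℝ (fun z => H z i) z v := fun z =>
      (((hCD i).differentiable (by simp)) z).lineDeriv_eq_fderiv
    simp only [h1] at h
    rw [← h]
    simp [lineDeriv]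
  unfold divergence
  simp_rw [← hfd]
  rw [integral_finsetSum]
  · simp [hzero]
  · intro i _
    exact (((hCD i).continuous_fderiv (by simp)).clm_apply
      continuous_const).integrable_of_hasCompactSupport ((hCS i).fderiv_apply ℝ _)

variable {Ω : Set Plane}

/-- Around an interior point the left side is zero, by compact support inside `Ω`; around a boundary
point a graph chart applies. -/
theorem IsLipschitzDomain.exists_local_divergence_le (hΩ : IsLipschitzDomain Ω) {x : Plane}
    (hx : x ∈ closure Ω) : ∃ ρ > 0, ∀ H : Plane → Plane, ContDiff ℝ 1 H → HasCompactSupport H →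
      tsupport H ⊆ Metric.ball x ρ →
      -∫ z in Ω, divergence H z ≤ ∫ z in frontier Ω, inwardFlux Ω H z ∂μH[1] := by
  by_cases hxΩ : x ∈ Ω
  · obtain ⟨ρ, hρ, hball⟩ := Metric.isOpen_iff.1 hΩ.isOpen x hxΩ
    refine ⟨ρ, hρ, fun H hH hc hs => ?_⟩
    rw [setIntegral_eq_integral_of_forall_compl_eq_zero, integral_divergence_eq_zero hH hc,
      neg_zero]
    · exact integral_nonneg fun z => inwardFlux_nonneg _ _ _
    · exact fun z hz => divergence_eq_zero_of_notMem_tsupport fun hzt => hz (hball (hs hzt))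
  · have hxf : x ∈ frontier Ω := by
      rw [hΩ.isOpen.frontier_eq]; exact ⟨hx, hxΩ⟩
    obtain ⟨e, g, K, r, h⟩ := hΩ.exists_isGraphChart hxf
    exact ⟨r, h.pos, fun H hH hc hs => h.neg_integral_divergence_le hΩ hH hc hs⟩

/-- The divergence theorem on a Lipschitz domain, as an upper bound by the inward flux. -/
theorem IsLipschitzDomain.neg_integral_divergence_le (hΩ : IsLipschitzDomain Ω)
    {G : Plane → Plane} (hG : ContDiff ℝ 1 G) :
    -∫ z in Ω, divergence G z ≤ ∫ z in frontier Ω, inwardFlux Ω G z ∂μH[1] := by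
  have hcpt : IsCompact (closure Ω) := hΩ.bounded.isCompact_closure
  choose! ρ hρ hloc using fun x (hx : x ∈ closure Ω) => hΩ.exists_local_divergence_le hx
  obtain ⟨t, htΩ, hcov⟩ := hcpt.elim_nhds_subcover (fun x => Metric.ball x (ρ x))
    fun x hx => Metric.ball_mem_nhds x (hρ x hx)
  -- Both sides are additive over a subordinate partition of unity: the divergence by linearity, the
  -- inward flux because the weights are nonnegative.
  obtain ⟨f, hf⟩ := SmoothPartitionOfUnity.exists_isSubordinate 𝓘(ℝ, Plane) isClosed_closure
    (fun x : t => Metric.ball (x : Plane) (ρ x)) (fun x => Metric.isOpen_ball) (by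
      intro z hz
      obtain ⟨x, hx, hzx⟩ := mem_iUnion₂.1 (hcov hz)
      exact mem_iUnion.2 ⟨⟨x, hx⟩, hzx⟩)
  have hfC : ∀ i, ContDiff ℝ 1 (f i) := fun i =>
    (contMDiff_iff_contDiff.1 (f i).contMDiff).of_le (by exact_mod_cast le_top)
  have hsum : ∀ z ∈ closure Ω, ∑ i, f i z = 1 := fun z hz => by
    rw [← finsum_eq_sum_of_fintype]; exact f.sum_eq_one hz
  have hHC : ∀ i, ContDiff ℝ 1 fun z => f i z • G z := fun i => (hfC i).smul hG
  have hts : ∀ i : t, tsupport (fun z => f i z • G z) ⊆ Metric.ball (i : Plane) (ρ i) := fun i =>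
    (tsupport_smul_subset_left (f i) G).trans (hf i)
  have hHS : ∀ i, HasCompactSupport fun z => f i z • G z := fun i =>
    Metric.isCompact_of_isClosed_isBounded (isClosed_tsupport _)
      (Metric.isBounded_ball.subset (hts i))
  have hdiv : ∀ z ∈ Ω, divergence G z = ∑ i, divergence (fun z => f i z • G z) z := by
    intro z hz
    have h1 : G =ᶠ[𝓝 z] fun z => ∑ i, f i z • G z := by
      filter_upwards [hΩ.isOpen.mem_nhds hz] with w hw
      rw [← Finset.sum_smul, hsum w (subset_closure hw), one_smul]
    unfold divergence
    rw [h1.fderiv_eq, fderiv_fun_sum fun i _ => (hHC i).differentiable (by simp) z]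
    simp only [FunLike.coe_sum, Finset.sum_apply, WithLp.ofLp_sum]
    rw [Finset.sum_comm]
  have hfl : ∀ z ∈ frontier Ω,
      inwardFlux Ω G z = ∑ i, inwardFlux Ω (fun z => f i z • G z) z := by
    intro z hz
    have h1 : ∀ i, inwardFlux Ω (fun z => f i z • G z) z = f i z * inwardFlux Ω G z := fun i =>
      inwardFlux_smul (f.nonneg i z)
    simp_rw [h1]
    rw [← Finset.sum_mul, hsum z (frontier_subset_closure hz), one_mul]
  rw [setIntegral_congr_fun hΩ.isOpen.measurableSet hdiv,
    setIntegral_congr_fun isClosed_frontier.measurableSet hfl, integral_finsetSum,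
    integral_finsetSum, ← Finset.sum_neg_distrib]
  · exact Finset.sum_le_sum fun i _ => hloc i (htΩ i i.2) _ (hHC i) (hHS i) (hts i)
  · exact fun i _ => hΩ.integrable_inwardFlux (hHC i).continuous
  · exact fun i _ => ((continuous_divergence
      (hHC i)).continuousOn.integrableOn_compact hcpt).mono_set subset_closure

/-- The boundary integral over the inflow part is the integral of the inward flux. -/
theorem IsLipschitzDomain.inflowTerm_eq (hΩ : IsLipschitzDomain Ω) {W : Plane → Plane}
    (hW : Continuous W) (u : Plane → ℝ) :
    inflowTerm Ω W u = ∫ z in frontier Ω, inwardFlux Ω (fun z => u z ^ 2 • W z) z ∂μH[1] := by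
  set μ := (μH[1] : Measure Plane).restrict (frontier Ω) with hμ
  have hm : AEMeasurable (fun z => inner ℝ (W z) (outwardNormal Ω z)) μ :=
    hW.measurable.aemeasurable.inner hΩ.boundary_measure.2
  -- The normal is only almost everywhere measurable, so the inflow part is only null measurable.
  have hnull : NullMeasurableSet (inflowBoundary Ω W) μ := by
    have h1 : NullMeasurableSet {z | inner ℝ (W z) (outwardNormal Ω z) < 0} μ :=
      nullMeasurableSet_lt hm aemeasurable_const
    exact (isClosed_frontier.measurableSet.nullMeasurableSet).inter h1
  have hsub : inflowBoundary Ω W ⊆ frontier Ω := fun z hz => hz.1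
  have hres : (μH[1] : Measure Plane).restrict (inflowBoundary Ω W) =
      μ.restrict (inflowBoundary Ω W) := by
    rw [hμ, Measure.restrict_restrict' isClosed_frontier.measurableSet,
      inter_eq_self_of_subset_left hsub]
  rw [inflowTerm, hres, ← integral_indicator₀ hnull]
  refine setIntegral_congr_fun isClosed_frontier.measurableSet fun z hz => ?_
  have h1 : inwardFlux Ω (fun z => u z ^ 2 • W z) z = u z ^ 2 * inwardFlux Ω W z :=
    inwardFlux_smul (sq_nonneg _)
  rw [h1, inwardFlux]
  by_cases hneg : inner ℝ (W z) (outwardNormal Ω z) < 0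
  · rw [indicator_of_mem (show z ∈ inflowBoundary Ω W from ⟨hz, hneg⟩), abs_of_neg hneg,
      max_eq_left (by linarith)]
  · rw [indicator_of_notMem (fun hzi : z ∈ inflowBoundary Ω W => hneg hzi.2),
      max_eq_right (by linarith [not_lt.1 hneg]), mul_zero]

theorem inflowTerm_nonneg (Ω : Set Plane) (W : Plane → Plane) (u : Plane → ℝ) :
    0 ≤ inflowTerm Ω W u :=
  integral_nonneg fun _ => mul_nonneg (sq_nonneg _) (abs_nonneg _)

theorem inflowTerm_congr {W : Plane → Plane} {u v : Plane → ℝ}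
    (h : EqOn u v (frontier Ω)) : inflowTerm Ω W u = inflowTerm Ω W v := by
  have hsub : inflowBoundary Ω W ⊆ frontier Ω := fun z hz => hz.1
  unfold inflowTerm
  refine integral_congr_ae ?_
  have h1 : ∀ᵐ z ∂(μH[1] : Measure Plane).restrict (frontier Ω), z ∈ frontier Ω :=
    ae_restrict_mem isClosed_frontier.measurableSet
  filter_upwards [ae_mono (Measure.restrict_mono_set _ hsub) h1] with z hz
  rw [h hz]

theorem divergence_smul {a : Plane → ℝ} {W : Plane → Plane} {z : Plane}
    (ha : DifferentiableAt ℝ a z) (hW : DifferentiableAt ℝ W z) :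
    divergence (fun z => a z • W z) z = a z * divergence W z + fderiv ℝ a z (W z) := by
  have h : fderiv ℝ a z (W z) = ∑ i, fderiv ℝ a z (EuclideanSpace.single i 1) * W z i := by
    conv_lhs => rw [← (EuclideanSpace.basisFun (Fin 2) ℝ).sum_repr (W z)]
    simp [mul_comm]
  unfold divergence
  rw [fderiv_fun_smul ha hW, h, Finset.mul_sum, ← Finset.sum_add_distrib]
  refine Finset.sum_congr rfl fun i _ => ?_
  simp

/-- Energy estimate for the advection by a solenoidal field: minus the integral of `u (W · ∇u)` is
controlled by the inflow. -/
theorem IsLipschitzDomain.neg_two_integral_advection_le (hΩ : IsLipschitzDomain Ω)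
    {W : Plane → Plane} (hW : ContDiff ℝ 1 W) (hdiv : ∀ z ∈ Ω, divergence W z = 0)
    {U : Set Plane} (hU : IsOpen U) (hΩU : closure Ω ⊆ U) {u : Plane → ℝ}
    (hu : ContDiffOn ℝ 1 u U) :
    -(2 * ∫ z in Ω, u z * fderiv ℝ u z (W z)) ≤ inflowTerm Ω W u := by
  -- The function `u` is regular only on `U`; a cutoff equal to `1` near the closure of `Ω` makes it
  -- `C¹` on the plane without changing either side.
  obtain ⟨χ, hχ0, hχ1, -⟩ := exists_contMDiffMap_zero_one_nhds_of_isClosed 𝓘(ℝ, Plane) (n := 1)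
    hU.isClosed_compl isClosed_closure (disjoint_left.2 fun z hz hz' => hz (hΩU hz'))
  have hχC : ContDiff ℝ 1 χ := contMDiff_iff_contDiff.1 χ.contMDiff
  set w : Plane → ℝ := fun z => χ z * u z with hw
  have hwC : ContDiff ℝ 1 w := by
    rw [contDiff_iff_contDiffAt]
    intro z
    by_cases hz : z ∈ U
    · exact hχC.contDiffAt.mul (hu.contDiffAt (hU.mem_nhds hz))
    · refine (contDiffAt_const (c := (0 : ℝ))).congr_of_eventuallyEq ?_
      filter_upwards [eventually_nhdsSet_iff_forall.1 hχ0 z hz] with y hy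
      simp [hw, hy]
  have hwu : EqOn w u (closure Ω) := fun z hz => by
    simp [hw, (eventually_nhdsSet_iff_forall.1 hχ1 z hz).self_of_nhds]
  have hG : ContDiff ℝ 1 fun z => w z ^ 2 • W z := (hwC.pow 2).smul hW
  have h1 := hΩ.neg_integral_divergence_le hG
  rw [← hΩ.inflowTerm_eq hW.continuous, inflowTerm_congr (hwu.mono frontier_subset_closure)] at h1
  refine le_trans (le_of_eq ?_) h1
  rw [← integral_const_mul]
  refine congrArg Neg.neg (setIntegral_congr_fun hΩ.isOpen.measurableSet fun z hz => ?_)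
  have hwz : DifferentiableAt ℝ w z := hwC.differentiable (by simp) z
  have heq : u =ᶠ[𝓝 z] w := by
    filter_upwards [hΩ.isOpen.mem_nhds hz] with y hy using (hwu (subset_closure hy)).symm
  have hsq : HasFDerivAt (fun z => w z ^ 2) ((2 * w z) • fderiv ℝ w z) z := by
    simpa using hwz.hasFDerivAt.pow 2
  rw [divergence_smul hsq.differentiableAt (hW.differentiable (by simp) z), hdiv z hz, mul_zero,
    zero_add, heq.fderiv_eq, heq.self_of_nhds, hsq.fderiv]
  simp [mul_assoc]

end Divergence

/-! ### Supremum norms and inverse inequalities -/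

section Inverse

open scoped BoundedContinuousFunction

/-- The kernel condition makes `B` factor through the range of `A`, and a linear map on a
finite-dimensional normed space is bounded. -/
theorem exists_bound_of_ker_le_ker {V E F : Type*} [AddCommGroup V] [Module ℝ V]
    [FiniteDimensional ℝ V] [NormedAddCommGroup E] [NormedSpace ℝ E] [NormedAddCommGroup F]
    [NormedSpace ℝ F] (A : V →ₗ[ℝ] E) (B : V →ₗ[ℝ] F)
    (h : LinearMap.ker A ≤ LinearMap.ker B) : ∃ κ : ℝ, 0 ≤ κ ∧ ∀ v, ‖B v‖ ≤ κ * ‖A v‖ := by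
  obtain ⟨s, hs⟩ := A.rangeRestrict.exists_rightInverse_of_surjective A.range_rangeRestrict
  set L : LinearMap.range A →L[ℝ] F := LinearMap.toContinuousLinearMap (B ∘ₗ s) with hL
  refine ⟨‖L‖, L.opNorm_nonneg, fun v => ?_⟩
  have h1 : A (v - s (A.rangeRestrict v)) = 0 := by
    have := LinearMap.congr_fun hs (A.rangeRestrict v)
    have h2 : A (s (A.rangeRestrict v)) = A v := congrArg Subtype.val this
    rw [map_sub, h2, sub_self]
  have h2 : B v = L (A.rangeRestrict v) := by
    have := h (LinearMap.mem_ker.2 h1)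
    rw [LinearMap.mem_ker, map_sub, sub_eq_zero] at this
    exact this
  rw [h2]
  exact L.le_opNorm _

/-! ### Suprema over sets. -/

variable {G : Type*} [NormedAddCommGroup G]

theorem supNorm_nonneg (K : Set Plane) (f : Plane → G) : 0 ≤ supNorm K f :=
  Real.iSup_nonneg fun _ => norm_nonneg _

theorem supNorm_le {K : Set Plane} {f : Plane → G} {c : ℝ} (hc : 0 ≤ c)
    (h : ∀ z ∈ K, ‖f z‖ ≤ c) : supNorm K f ≤ c :=
  Real.iSup_le (fun z => h z z.2) hc

theorem supNorm_congr {K : Set Plane} {f g : Plane → G} (h : EqOn f g K) :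
    supNorm K f = supNorm K g := by
  unfold supNorm
  exact iSup_congr fun z => by rw [h z.2]

/-- The compact set `S` supplies boundedness; without it the real supremum could take its default
value `0`. -/
theorem norm_le_supNorm {K S : Set Plane} {f : Plane → G} (hS : IsCompact S) (hKS : K ⊆ S)
    (hf : ContinuousOn f S) {z : Plane} (hz : z ∈ K) : ‖f z‖ ≤ supNorm K f := by
  obtain ⟨C, hC⟩ := hS.exists_bound_of_continuousOn hf
  exact le_ciSup (f := fun z : K => ‖f z‖)
    ⟨C, by rintro _ ⟨w, rfl⟩; exact hC w (hKS w.2)⟩ ⟨z, hz⟩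

variable {Ω : Set Plane} {N : ℕ} {X : Fin N → Plane}

/-! ### Geometry of the Voronoi cells, and the inverse inequality. -/

theorem voronoiCell_subset (Ω : Set Plane) (X : Fin N → Plane) (i : Fin N) :
    voronoiCell Ω X i ⊆ Ω := fun _ hz => hz.1

theorem exists_mem_voronoiCell (hN : 0 < N) {z : Plane} (hz : z ∈ Ω) :
    ∃ i, z ∈ voronoiCell Ω X i := by
  have : Nonempty (Fin N) := ⟨⟨0, hN⟩⟩
  obtain ⟨i, hi⟩ := Finite.exists_min fun j => ‖z - X j‖
  exact ⟨i, hz, hi⟩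

/-- A difference of squared distances to two points is affine along a segment. -/
theorem norm_sub_sq_sub_norm_sub_sq (z a b : Plane) (t : ℝ) :
    ‖z + t • (b - z) - a‖ ^ 2 - ‖z + t • (b - z) - b‖ ^ 2 =
      (1 - t) * (‖z - a‖ ^ 2 - ‖z - b‖ ^ 2) + t * ‖b - a‖ ^ 2 := by
  simp only [EuclideanSpace.norm_sq_eq, Fin.sum_univ_two, Real.norm_eq_abs, sq_abs,
    PiLp.sub_apply, PiLp.add_apply, PiLp.smul_apply, smul_eq_mul]
  ring

/-- A small move from a point of the cell towards its node stays in the open set `Ω` and makes every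
inequality with another node strict. -/
theorem voronoiCell_subset_closure_interior (hΩ : IsOpen Ω) (hX : Function.Injective X)
    (i : Fin N) : voronoiCell Ω X i ⊆ closure (interior (voronoiCell Ω X i)) := by
  rintro z ⟨hzΩ, hz⟩
  set D : Set Plane := Ω ∩ ⋂ j, {w : Plane | j = i ∨ ‖w - X i‖ < ‖w - X j‖} with hD
  have hDo : IsOpen D := by
    refine hΩ.inter (isOpen_iInter_of_finite fun j => ?_)
    by_cases hj : j = i
    · simp [hj]
    · simp only [hj, false_or]
      exact isOpen_lt (by fun_prop) (by fun_prop)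
  have hDK : D ⊆ voronoiCell Ω X i := by
    rintro w ⟨hw, hw'⟩
    refine ⟨hw, fun j => ?_⟩
    rcases mem_iInter.1 hw' j with rfl | h
    · exact le_rfl
    · exact h.le
  refine closure_mono (interior_maximal hDK hDo) ?_
  have ht : Tendsto (fun t : ℝ => z + t • (X i - z)) (𝓝[>] 0) (𝓝 z) := by
    have hc : Continuous fun t : ℝ => z + t • (X i - z) := by fun_prop
    have := hc.tendsto 0
    simp only [zero_smul, add_zero] at this
    exact this.mono_left nhdsWithin_le_nhds
  refine mem_closure_of_tendsto ht ?_
  filter_upwards [ht (hΩ.mem_nhds hzΩ), Ioc_mem_nhdsGT (zero_lt_one' ℝ)] with t h1 h2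
  refine ⟨h1, mem_iInter.2 fun j => ?_⟩
  by_cases hj : j = i
  · exact Or.inl hj
  · refine Or.inr ?_
    have h3 := norm_sub_sq_sub_norm_sub_sq z (X j) (X i) t
    have h4 : 0 < ‖X i - X j‖ := norm_pos_iff.2 (sub_ne_zero.2 fun h => hj (hX h).symm)
    have h5 : ‖z - X i‖ ^ 2 ≤ ‖z - X j‖ ^ 2 := by gcongr; exact hz j
    have h6 : 0 < t * ‖X i - X j‖ ^ 2 := mul_pos h2.1 (by positivity)
    have h7 : 0 ≤ (1 - t) * (‖z - X j‖ ^ 2 - ‖z - X i‖ ^ 2) :=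
      mul_nonneg (by linarith [h2.2]) (by linarith)
    exact lt_of_pow_lt_pow_left₀ 2 (norm_nonneg _) (by linarith)

theorem fderiv_eq_zero_of_eqOn_zero {U K : Set Plane} {f : Plane → ℝ} (hU : IsOpen U)
    (hK : K ⊆ closure (interior K)) (hKU : K ⊆ U) (hf : ContDiffOn ℝ 1 f U)
    (h0 : ∀ z ∈ K, f z = 0) {z : Plane} (hz : z ∈ K) : fderiv ℝ f z = 0 := by
  have hc : ContinuousAt (fderiv ℝ f) z :=
    (hf.continuousOn_fderiv_of_isOpen hU le_rfl).continuousAt (hU.mem_nhds (hKU hz))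
  have h1 : ∀ w ∈ interior K, fderiv ℝ f w = 0 := by
    intro w hw
    have : f =ᶠ[𝓝 w] fun _ => 0 := by
      filter_upwards [isOpen_interior.mem_nhds hw] with y hy using h0 y (interior_subset hy)
    rw [this.fderiv_eq, fderiv_fun_const]; rfl
  have h2 : fderiv ℝ f z ∈ closure (fderiv ℝ f '' interior K) :=
    mem_closure_image hc (hK hz)
  have h3 : fderiv ℝ f '' interior K ⊆ {0} := by
    rintro _ ⟨w, hw, rfl⟩; exact h1 w hw
  simpa using closure_mono h3 h2

/-- Coefficients are mapped linearly to the function and to its gradient, both as bounded continuous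
functions on `K`. By `fderiv_eq_zero_of_eqOn_zero` the first kernel lies in the second, so the `b i`
need not be linearly independent on `K`. -/
theorem exists_inverse_bound {ι : Type*} [Fintype ι] {U S K : Set Plane} (hU : IsOpen U)
    (hS : IsCompact S) (hSU : S ⊆ U) (hKS : K ⊆ S) (hK : K ⊆ closure (interior K))
    {b : ι → Plane → ℝ} (hb : ∀ i, ContDiffOn ℝ 1 (b i) U) :
    ∃ κ : ℝ, 0 ≤ κ ∧ ∀ c : ι → ℝ, supNorm K (fderiv ℝ fun z => ∑ i, c i * b i z) ≤
      κ * supNorm K fun z => ∑ i, c i * b i z := by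
  have hbd : ∀ i, ContinuousOn (fderiv ℝ (b i)) U := fun i =>
    (hb i).continuousOn_fderiv_of_isOpen hU le_rfl
  have hfd : ∀ (c : ι → ℝ), ∀ z ∈ K, fderiv ℝ (fun z => ∑ i, c i * b i z) z =
      ∑ i, c i • fderiv ℝ (b i) z := by
    intro c z hz
    have hd : ∀ i, DifferentiableAt ℝ (b i) z := fun i =>
      ((hb i).contDiffAt (hU.mem_nhds (hSU (hKS hz)))).differentiableAt (by simp)
    rw [fderiv_fun_sum fun i _ => (hd i).const_mul (c i)]
    exact Finset.sum_congr rfl fun i _ => fderiv_const_mul (hd i) (c i)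
  have mk : ∀ {E : Type} [NormedAddCommGroup E] (f : Plane → E), ContinuousOn f U →
      ∃ F : K →ᵇ E, ∀ z, F z = f z := by
    intro E _ f hf
    obtain ⟨C, hC⟩ := hS.exists_bound_of_continuousOn (hf.mono hSU)
    exact ⟨BoundedContinuousFunction.ofNormedAddCommGroup (fun z : K => f z)
      (continuousOn_iff_continuous_domRestrict.1 (hf.mono (hKS.trans hSU))) C
      fun z => hC z (hKS z.2), fun z => rfl⟩
  choose a ha using fun i => mk (b i) (hb i).continuousOn
  choose d hd using fun i => mk (fderiv ℝ (b i)) (hbd i)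
  have hA : ∀ (c : ι → ℝ) (z : K), Fintype.linearCombination ℝ a c z = ∑ i, c i * b i z := by
    intro c z
    simp [Fintype.linearCombination_apply, ha]
  have hB : ∀ (c : ι → ℝ) (z : K), Fintype.linearCombination ℝ d c z =
      fderiv ℝ (fun z => ∑ i, c i * b i z) z := by
    intro c z
    rw [hfd c z z.2]
    simp [Fintype.linearCombination_apply, hd]
  obtain ⟨κ, hκ, hle⟩ := exists_bound_of_ker_le_ker (Fintype.linearCombination ℝ a)
    (Fintype.linearCombination ℝ d) (by
      intro c hc
      rw [LinearMap.mem_ker] at hc ⊢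
      ext1 z
      rw [hB]
      refine fderiv_eq_zero_of_eqOn_zero hU hK (hKS.trans hSU)
        (ContDiffOn.sum fun i _ => contDiffOn_const.mul (hb i)) (fun w hw => ?_) z.2
      have := hA c ⟨w, hw⟩
      rw [hc] at this
      exact this.symm)
  refine ⟨κ, hκ, fun c => ?_⟩
  have h1 : supNorm K (fun z => ∑ i, c i * b i z) = ‖Fintype.linearCombination ℝ a c‖ := by
    rw [BoundedContinuousFunction.norm_eq_iSup_norm, supNorm]
    exact iSup_congr fun z => by rw [hA]
  have h2 : supNorm K (fderiv ℝ fun z => ∑ i, c i * b i z) =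
      ‖Fintype.linearCombination ℝ d c‖ := by
    rw [BoundedContinuousFunction.norm_eq_iSup_norm, supNorm]
    exact iSup_congr fun z => by rw [hB]
  rw [h1, h2]
  exact hle c

theorem nodeSpacing_pos (hΩ : IsLipschitzDomain Ω) (hN : 0 < N) : 0 < nodeSpacing Ω N := by
  refine Real.sqrt_pos.2 (div_pos ?_ (by exact_mod_cast hN))
  exact ENNReal.toReal_pos (hΩ.isOpen.measure_pos volume hΩ.nonempty).ne'
    hΩ.bounded.measure_lt_top.ne

/-- One constant serves in the inverse inequality for all sets of functions which coincide on `Ω`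
with combinations of finitely many functions of class `C¹`. -/
theorem exists_inverseInequality (hΩ : IsLipschitzDomain Ω) (hX : Function.Injective X)
    {ι : Type*} [Fintype ι] {U : Set Plane} (hU : IsOpen U) (hΩU : closure Ω ⊆ U)
    {b : ι → Plane → ℝ} (hb : ∀ i, ContDiffOn ℝ 1 (b i) U) :
    ∃ κ : ℝ, ∀ S : Set (Plane → ℝ),
      (∀ f ∈ S, ∃ c : ι → ℝ, EqOn f (fun z => ∑ i, c i * b i z) Ω) →
      InverseInequality Ω X S κ := by
  choose κ hκ hle using fun i => exists_inverse_bound hU hΩ.bounded.isCompact_closure hΩU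
    ((voronoiCell_subset Ω X i).trans subset_closure)
    (voronoiCell_subset_closure_interior hΩ.isOpen hX i) hb
  -- The factor `h` cancels the `h⁻¹` of the inverse inequality, and the sum dominates the constant
  -- of every cell.
  refine ⟨nodeSpacing Ω N * ∑ i, κ i, fun S hS =>
    ⟨mul_nonneg (Real.sqrt_nonneg _) (Finset.sum_nonneg fun i _ => hκ i), fun f hf i => ?_⟩⟩
  obtain ⟨c, hc⟩ := hS f hf
  have hK := voronoiCell_subset Ω X i
  have h1 : EqOn (fderiv ℝ f) (fderiv ℝ fun z => ∑ i, c i * b i z) (voronoiCell Ω X i) := by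
    intro z hz
    refine Filter.EventuallyEq.fderiv_eq ?_
    filter_upwards [hΩ.isOpen.mem_nhds (hK hz)] with y hy using hc hy
  rw [supNorm_congr h1, supNorm_congr (hc.mono hK)]
  refine (hle i c).trans ?_
  have hh := nodeSpacing_pos (N := N) hΩ i.pos
  rw [mul_comm (nodeSpacing Ω N), mul_assoc _ (nodeSpacing Ω N), mul_inv_cancel₀ hh.ne', mul_one]
  exact mul_le_mul_of_nonneg_right
    (Finset.single_le_sum (f := κ) (fun j _ => hκ j) (Finset.mem_univ i)) (supNorm_nonneg _ _)

theorem bddBelow_inverseInequality (Ω : Set Plane) (X : Fin N → Plane) (S : Set (Plane → ℝ)) :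
    BddBelow {κ | InverseInequality Ω X S κ} := ⟨0, fun _ h => h.1⟩

theorem inverseConst_nonneg (Ω : Set Plane) (X : Fin N → Plane) (S : Set (Plane → ℝ)) :
    0 ≤ inverseConst Ω X S := Real.sInf_nonneg fun _ h => h.1

theorem InverseInequality.inverseConst_le {S : Set (Plane → ℝ)} {κ : ℝ}
    (h : InverseInequality Ω X S κ) : inverseConst Ω X S ≤ κ :=
  csInf_le (bddBelow_inverseInequality Ω X S) h

/-- The smallest constant in the inverse inequality is attained. -/
theorem InverseInequality.inverseConst {S : Set (Plane → ℝ)} {κ : ℝ}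
    (h : InverseInequality Ω X S κ) : InverseInequality Ω X S (inverseConst Ω X S) := by
  have hcl : IsClosed {κ | InverseInequality Ω X S κ} := by
    have heq : {κ | InverseInequality Ω X S κ} = Ici 0 ∩ ⋂ f ∈ S, ⋂ i,
        {κ | supNorm (voronoiCell Ω X i) (fderiv ℝ f) ≤
          κ * (nodeSpacing Ω N)⁻¹ * supNorm (voronoiCell Ω X i) f} := by
      ext κ; simp [InverseInequality]
    rw [heq]
    exact isClosed_Ici.inter (isClosed_biInter fun f _ => isClosed_iInter fun i =>
      isClosed_le continuous_const (by fun_prop))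
  exact hcl.csInf_mem ⟨κ, h⟩ (bddBelow_inverseInequality Ω X S)

/-! ### The trial space -/

variable {U : Set Plane} {Ψ : Fin N → Plane → ℝ}

theorem contDiffOn_ansatz (hΨ : ∀ i, ContDiffOn ℝ 2 (Ψ i) U) (v : Fin N → ℝ) :
    ContDiffOn ℝ 2 (ansatz Ψ v) U :=
  ContDiffOn.sum fun i _ => contDiffOn_const.mul (hΨ i)

theorem fderiv_ansatz (hU : IsOpen U) (hΨ : ∀ i, ContDiffOn ℝ 2 (Ψ i) U) (v : Fin N → ℝ)
    {z : Plane} (hz : z ∈ U) : fderiv ℝ (ansatz Ψ v) z = ∑ i, v i • fderiv ℝ (Ψ i) z := by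
  have hd : ∀ i, DifferentiableAt ℝ (Ψ i) z := fun i =>
    ((hΨ i).contDiffAt (hU.mem_nhds hz)).differentiableAt (by simp)
  unfold ansatz
  rw [fderiv_fun_sum fun i _ => (hd i).const_mul (v i)]
  exact Finset.sum_congr rfl fun i _ => fderiv_const_mul (hd i) (v i)

theorem contDiffOn_mul_fderiv_apply (hU : IsOpen U) {u w : Plane → ℝ}
    (hu : ContDiffOn ℝ 2 u U) (hw : ContDiffOn ℝ 2 w U) {W : Plane → Plane}
    (hW : ContDiff ℝ 1 W) : ContDiffOn ℝ 1 (fun z => u z * fderiv ℝ w z (W z)) U :=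
  (hu.of_le (by norm_num)).mul
    ((hw.fderiv_of_isOpen hU (by norm_num)).clm_apply hW.contDiffOn)

theorem exists_inverseInequality_trialSpace (hΩ : IsLipschitzDomain Ω)
    (hX : Function.Injective X) (hU : IsOpen U) (hΩU : closure Ω ⊆ U)
    (hΨ : ∀ i, ContDiffOn ℝ 2 (Ψ i) U) : ∃ κ, InverseInequality Ω X (trialSpace Ψ) κ := by
  obtain ⟨κ, h⟩ := exists_inverseInequality hΩ hX hU hΩU
    fun i => (hΨ i).of_le (by norm_num : (1 : WithTop ℕ∞) ≤ 2)
  refine ⟨κ, h _ ?_⟩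
  rintro _ ⟨v, rfl⟩
  exact ⟨v, fun z _ => rfl⟩

/-- The integrands are quadratic in `u` and do not form a linear space, but they lie in the span of
the products `Ψ_i (W · ∇Ψ_j)`. -/
theorem exists_inverseInequality_advection (hΩ : IsLipschitzDomain Ω)
    (hX : Function.Injective X) (hU : IsOpen U) (hΩU : closure Ω ⊆ U)
    (hΨ : ∀ i, ContDiffOn ℝ 2 (Ψ i) U) {W : Plane → Plane} (hW : ContDiff ℝ 1 W) :
    ∃ κ, InverseInequality Ω X (advectionIntegrands Ψ W) κ := by
  obtain ⟨κ, h⟩ := exists_inverseInequality hΩ hX hU hΩU (ι := Fin N × Fin N)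
    fun q => contDiffOn_mul_fderiv_apply hU (hΨ q.1) (hΨ q.2) hW
  refine ⟨κ, h _ ?_⟩
  rintro _ ⟨_, ⟨v, rfl⟩, rfl⟩
  refine ⟨fun q => v q.1 * v q.2, fun z hz => ?_⟩
  have hzU := hΩU (subset_closure hz)
  simp only [fderiv_ansatz hU hΨ v hzU, ansatz, Fintype.sum_prod_type, FunLike.coe_sum,
    Finset.sum_apply, FunLike.coe_smul, Pi.smul_apply, smul_eq_mul, Finset.sum_mul_sum]
  exact Finset.sum_congr rfl fun i _ => Finset.sum_congr rfl fun j _ => by ring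

/-- The products `Ψ_i ∂_k Ψ_j` span a space that contains the integrands for every constant `w`, so
one constant serves all. -/
theorem exists_inverseInequality_advection_const (hΩ : IsLipschitzDomain Ω)
    (hX : Function.Injective X) (hU : IsOpen U) (hΩU : closure Ω ⊆ U)
    (hΨ : ∀ i, ContDiffOn ℝ 2 (Ψ i) U) :
    ∃ κ, ∀ w : Plane, InverseInequality Ω X (advectionIntegrands Ψ fun _ => w) κ := by
  obtain ⟨κ, h⟩ := exists_inverseInequality hΩ hX hU hΩU (ι := Fin N × Fin N × Fin 2)
    fun q => contDiffOn_mul_fderiv_apply hU (hΨ q.1) (hΨ q.2.1)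
      (contDiff_const (c := (EuclideanSpace.single q.2.2 1 : Plane)))
  refine ⟨κ, fun w => h _ ?_⟩
  rintro _ ⟨_, ⟨v, rfl⟩, rfl⟩
  refine ⟨fun q => v q.1 * v q.2.1 * w q.2.2, fun z hz => ?_⟩
  have hzU := hΩU (subset_closure hz)
  have hw : ∀ L : Plane →L[ℝ] ℝ, L w = ∑ k, w k * L (EuclideanSpace.single k 1) := by
    intro L
    conv_lhs => rw [← (EuclideanSpace.basisFun (Fin 2) ℝ).sum_repr w]
    simp
  simp only [fderiv_ansatz hU hΨ v hzU, ansatz, Fintype.sum_prod_type, FunLike.coe_sum,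
    Finset.sum_apply, FunLike.coe_smul, Pi.smul_apply, smul_eq_mul, Finset.sum_mul_sum]
  refine Finset.sum_congr rfl fun i _ => Finset.sum_congr rfl fun j _ => ?_
  rw [hw, Finset.mul_sum, Finset.mul_sum]
  exact Finset.sum_congr rfl fun k _ => by ring

end Inverse

/-! ### The quadrature error of a Cartesian grid -/

section Quadrature

open scoped ENNReal

theorem volume_graph_strip {g : ℝ → ℝ} (hg : Continuous g) (a b w : ℝ) :
    volume {p : ℝ × ℝ | p.1 ∈ Icc a b ∧ |p.2 - g p.1| ≤ w} =
      ENNReal.ofReal (b - a) * ENNReal.ofReal (2 * w) := by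
  rw [← (measurePreserving_shear hg).measure_preimage_emb
    (shearHomeomorph g hg).measurableEmbedding]
  have hpre : (shearHomeomorph g hg) ⁻¹' {p : ℝ × ℝ | p.1 ∈ Icc a b ∧ |p.2 - g p.1| ≤ w} =
      Icc a b ×ˢ Icc (-w) w := by
    ext p
    simp only [shearHomeomorph, mem_preimage, mem_ofPred_eq, Homeomorph.homeomorph_mk_coe,
      Equiv.coe_fn_mk, add_sub_cancel_left, mem_prod, mem_Icc, abs_le]
  rw [hpre, Measure.volume_eq_prod, Measure.prod_prod, Real.volume_Icc, Real.volume_Icc]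
  congr 2
  ring

variable {e : Plane ≃ₗᵢ[ℝ] Plane} {Ω : Set Plane} {p : Plane} {g : ℝ → ℝ} {K : ℝ≥0} {r : ℝ}

/-- A point within `s` of the graph is within `(1 + K) s` of it vertically, and the horizontal
extent is at most `2 (r + S)`. The bound `S` on `s` is what makes the area estimate linear in `s`.
-/
theorem IsGraphChart.volume_layer_le (h : IsGraphChart e Ω p g K r) (hΩ : IsOpen Ω) {s S : ℝ}
    (hs : s ≤ S) (hs0 : 0 ≤ s) :
    volume (⋃ q ∈ frontier Ω ∩ Metric.ball p r, Metric.closedBall q s) ≤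
      ENNReal.ofReal (4 * (r + S) * (1 + K) * s) := by
  set a := (e p) 0 with ha
  set T : Set (ℝ × ℝ) := {q | q.1 ∈ Icc (a - (r + S)) (a + (r + S)) ∧
    |q.2 - g q.1| ≤ (1 + K) * s} with hT
  have hvol : volume T = ENNReal.ofReal (4 * (r + S) * (1 + K) * s) := by
    have hr := h.pos
    rw [hT, volume_graph_strip h.lipschitz.continuous, ← ENNReal.ofReal_mul (by linarith)]
    congr 1
    ring
  have hemb : MeasurableEmbedding (frameMap e) := (frameHomeomorph e).measurableEmbedding
  rw [← hvol, ← (measurePreserving_frameMap e).measure_preimage_emb hemb]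
  refine measure_mono ?_
  intro y hy
  simp only [mem_preimage, mem_iUnion₂] at hy
  obtain ⟨q, ⟨hq, hqb⟩, hyq⟩ := hy
  rw [mem_closedBall_iff_norm] at hyq
  have hgr := (h.mem_frontier_iff hΩ hqb).1 hq
  rw [mem_ball_iff_norm] at hqb
  have h0 := (abs_coord_le_norm e _ 0).trans hyq
  have h1 := (abs_coord_le_norm e _ 1).trans hyq
  have h2 := (abs_coord_le_norm e _ 0).trans hqb.le
  rw [map_sub, PiLp.sub_apply] at h0 h1 h2
  rw [frameMap_coord_zero] at h0
  rw [frameMap_coord_one, hgr] at h1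
  refine ⟨?_, ?_⟩
  · rw [abs_le] at h0 h2
    constructor <;> linarith [h0.1, h0.2, h2.1, h2.2]
  · have h3 : |g ((e q) 0) - g y.1| ≤ K * s := by
      have h4 := h.lipschitz.dist_le_mul ((e q) 0) y.1
      rw [Real.dist_eq, Real.dist_eq, abs_sub_comm _ y.1] at h4
      exact h4.trans (by gcongr)
    calc |y.2 - g y.1| = |(y.2 - g ((e q) 0)) + (g ((e q) 0) - g y.1)| := by ring_nf
      _ ≤ |y.2 - g ((e q) 0)| + |g ((e q) 0) - g y.1| := abs_add_le _ _
      _ ≤ (1 + K) * s := by linarith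

/-- The volume of a boundary layer is at most proportional to its width. -/
theorem IsLipschitzDomain.exists_volume_layer_le (hΩ : IsLipschitzDomain Ω) {S : ℝ}
    (hS : 0 ≤ S) : ∃ C : ℝ, 0 ≤ C ∧ ∀ s, 0 ≤ s → s ≤ S →
      volume (⋃ q ∈ frontier Ω, Metric.closedBall q s) ≤ ENNReal.ofReal (C * s) := by
  refine hΩ.isCompact_frontier.induction_on (p := fun A => ∃ C : ℝ, 0 ≤ C ∧ ∀ s, 0 ≤ s → s ≤ S →
      volume (⋃ q ∈ A, Metric.closedBall q s) ≤ ENNReal.ofReal (C * s)) ?_ ?_ ?_ ?_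
  · exact ⟨0, le_rfl, by simp⟩
  · rintro A B hAB ⟨C, hC, h⟩
    exact ⟨C, hC, fun s h0 h1 => (measure_mono (biUnion_subset_biUnion_left hAB)).trans
      (h s h0 h1)⟩
  · rintro A B ⟨C, hC, h⟩ ⟨D, hD, h'⟩
    refine ⟨C + D, add_nonneg hC hD, fun s h0 h1 => ?_⟩
    rw [biUnion_union, add_mul, ENNReal.ofReal_add (by positivity) (by positivity)]
    exact (measure_union_le _ _).trans (add_le_add (h s h0 h1) (h' s h0 h1))
  · intro p hp
    obtain ⟨e, g, K, r, h⟩ := hΩ.exists_isGraphChart hp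
    have hr := h.pos
    exact ⟨frontier Ω ∩ Metric.ball p r,
      inter_mem self_mem_nhdsWithin (mem_nhdsWithin_of_mem_nhds (Metric.ball_mem_nhds p h.pos)),
      4 * (r + S) * (1 + K), by positivity, fun s h0 h1 => h.volume_layer_le hΩ.isOpen h1 h0⟩

/-- The grid point with offset `a` and mesh size `s` below and to the left of `z`. -/
noncomputable def gridFloor (a : Plane) (s : ℝ) (z : Plane) : Plane :=
  WithLp.toLp 2 fun i => a i + s * ⌊(z i - a i) / s⌋

/-- The half open square with lower left corner `q` and side length `s`. -/
def gridCell (s : ℝ) (q : Plane) : Set Plane := {z | ∀ i, z i ∈ Ico (q i) (q i + s)}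

/-! ### The tiling of the plane by grid cells. -/

variable {s : ℝ}

theorem gridFloor_mem_grid (a : Plane) (s : ℝ) (z : Plane) :
    ∃ n : Fin 2 → ℤ, ∀ i, gridFloor a s z i = a i + s * n i :=
  ⟨fun i => ⌊(z i - a i) / s⌋, fun _ => rfl⟩

theorem mem_gridCell_iff (hs : 0 < s) {a q z : Plane}
    (hq : ∃ n : Fin 2 → ℤ, ∀ i, q i = a i + s * n i) :
    z ∈ gridCell s q ↔ gridFloor a s z = q := by
  obtain ⟨n, hn⟩ := hq
  have h1 : gridFloor a s z = q ↔ ∀ i, ⌊(z i - a i) / s⌋ = n i := by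
    constructor
    · intro h i
      have h2 : gridFloor a s z i = q i := by rw [h]
      rw [hn i] at h2
      have h3 : s * (⌊(z i - a i) / s⌋ : ℝ) = s * n i := add_left_cancel h2
      exact_mod_cast mul_left_cancel₀ hs.ne' h3
    · intro h
      ext i
      rw [hn i, ← h i]
      rfl
  rw [h1]
  refine forall_congr' fun i => ?_
  rw [Int.floor_eq_iff, le_div_iff₀ hs, div_lt_iff₀ hs, hn i, mem_Ico]
  constructor
  · rintro ⟨h2, h3⟩; constructor <;> nlinarith
  · rintro ⟨h2, h3⟩; constructor <;> nlinarith

theorem norm_sub_gridFloor_le (hs : 0 < s) (a z : Plane) : ‖z - gridFloor a s z‖ ≤ 2 * s := by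
  have h := (mem_gridCell_iff hs (gridFloor_mem_grid a s z)).2 rfl
  have h2 : ‖z - gridFloor a s z‖ ^ 2 ≤ (2 * s) ^ 2 := by
    rw [EuclideanSpace.norm_sq_eq, Fin.sum_univ_two]
    have hi : ∀ i : Fin 2, ‖(z - gridFloor a s z) i‖ ^ 2 ≤ s ^ 2 := by
      intro i
      obtain ⟨h3, h4⟩ := h i
      rw [PiLp.sub_apply]
      refine pow_le_pow_left₀ (norm_nonneg _) ?_ 2
      rw [Real.norm_eq_abs, abs_le]
      constructor <;> linarith
    nlinarith [hi 0, hi 1]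
  exact le_of_pow_le_pow_left₀ two_ne_zero (by positivity) h2

theorem gridCell_eq_preimage (s : ℝ) (q : Plane) :
    gridCell s q = WithLp.ofLp ⁻¹' (univ.pi fun i => Ico (q i) (q i + s)) := by
  ext z; simp [gridCell]

theorem measurableSet_gridCell (s : ℝ) (q : Plane) : MeasurableSet (gridCell s q) := by
  rw [gridCell_eq_preimage]
  exact (PiLp.volume_preserving_ofLp (Fin 2)).measurable
    (MeasurableSet.univ_pi fun i => measurableSet_Ico)

theorem volume_gridCell (hs : 0 < s) (q : Plane) :
    volume (gridCell s q) = ENNReal.ofReal (s ^ 2) := by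
  rw [gridCell_eq_preimage, (PiLp.volume_preserving_ofLp (Fin 2)).measure_preimage
    (MeasurableSet.univ_pi fun i => measurableSet_Ico).nullMeasurableSet, Real.volume_pi_Ico]
  simp [← ENNReal.ofReal_mul hs.le, sq]

variable {M : ℕ} {y : Fin M → Plane}

/-- Its integral over the plane is the quadrature sum, since each cell has area `s²`. -/
theorem indicator_gridFloor_eq_sum (hs : 0 < s) {a : Plane} (hy : Function.Injective y)
    (hr : range y = {z ∈ Ω | ∃ n : Fin 2 → ℤ, ∀ i, z i = a i + s * n i}) (f : Plane → ℝ)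
    (z : Plane) : Ω.indicator f (gridFloor a s z) =
      ∑ k, (gridCell s (y k)).indicator (fun _ => f (y k)) z := by
  have hmem : ∀ k, z ∈ gridCell s (y k) ↔ gridFloor a s z = y k := by
    intro k
    have h1 : y k ∈ range y := mem_range_self k
    rw [hr] at h1
    exact mem_gridCell_iff hs h1.2
  by_cases hz : gridFloor a s z ∈ Ω
  · have h1 : gridFloor a s z ∈ range y := by
      rw [hr]; exact ⟨hz, gridFloor_mem_grid a s z⟩
    obtain ⟨k, hk⟩ := h1
    rw [indicator_of_mem hz, Finset.sum_eq_single k, indicator_of_mem ((hmem k).2 hk.symm), hk]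
    · intro j _ hj
      exact indicator_of_notMem (fun h => hj (hy (((hmem j).1 h).symm.trans hk.symm))) _
    · simp
  · rw [indicator_of_notMem hz, Finset.sum_eq_zero]
    intro k _
    refine indicator_of_notMem (fun h => hz ?_) _
    rw [(hmem k).1 h]
    have h1 : y k ∈ range y := mem_range_self k
    rw [hr] at h1
    exact h1.1

/-- Otherwise `A` and the complement of its closure would disconnect `T`. -/
theorem inter_frontier_nonempty_of_isPreconnected {α : Type*} [TopologicalSpace α] {A T : Set α}
    (hA : IsOpen A) (hT : IsPreconnected T) (h1 : (T ∩ A).Nonempty) (h2 : (T ∩ Aᶜ).Nonempty) :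
    (T ∩ frontier A).Nonempty := by
  by_contra hne
  rw [hA.frontier_eq, not_nonempty_iff_eq_empty] at hne
  have hcl : ∀ x ∈ T, x ∉ A → x ∉ closure A := fun x hx hxA hxc =>
    (Set.eq_empty_iff_forall_notMem.1 hne x) ⟨hx, hxc, hxA⟩
  obtain ⟨x, hx, hxA⟩ := h2
  obtain ⟨z, -, hzA, hzc⟩ := hT A (closure A)ᶜ hA isClosed_closure.isOpen_compl
    (fun z hz => or_iff_not_imp_left.2 (hcl z hz)) h1 ⟨x, hx, hcl x hx hxA⟩
  exact hzc (subset_closure hzA)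

/-- If the segment from `z` to its grid point stays in `Ω`, the mean value inequality applies. If it
leaves `Ω` with an end point inside, it meets the boundary, so `z` is in the layer. Otherwise both
values are `0`, or the segment would have an end point in `Ω`. -/
theorem abs_indicator_gridFloor_sub_le (hΩ : IsOpen Ω) (hs : 0 < s) (a : Plane)
    {f : Plane → ℝ} {B L : ℝ} (hf : ∀ z ∈ Ω, DifferentiableAt ℝ f z) (hB : ∀ z ∈ Ω, |f z| ≤ B)
    (hL : ∀ z ∈ Ω, ‖fderiv ℝ f z‖ ≤ L) (hB0 : 0 ≤ B) (hL0 : 0 ≤ L) (z : Plane) :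
    |Ω.indicator f (gridFloor a s z) - Ω.indicator f z| ≤
      Ω.indicator (fun _ => L * (2 * s)) z +
      (⋃ q ∈ frontier Ω, Metric.closedBall q (2 * s)).indicator (fun _ => 2 * B) z := by
  set w := gridFloor a s z with hw
  have hzw : ‖z - w‖ ≤ 2 * s := norm_sub_gridFloor_le hs a z
  have hn1 : 0 ≤ Ω.indicator (fun _ => L * (2 * s)) z :=
    indicator_nonneg (fun _ _ => by positivity) _
  have hn2 : 0 ≤ (⋃ q ∈ frontier Ω, Metric.closedBall q (2 * s)).indicator (fun _ => 2 * B) z :=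
    indicator_nonneg (fun _ _ => by positivity) _
  by_cases hseg : segment ℝ z w ⊆ Ω
  · have hzΩ := hseg (left_mem_segment ℝ z w)
    have hwΩ := hseg (right_mem_segment ℝ z w)
    rw [indicator_of_mem hwΩ, indicator_of_mem hzΩ, indicator_of_mem hzΩ]
    have h1 := (convex_segment z w).norm_image_sub_le_of_norm_hasFDerivWithin_le (f := f)
      (f' := fderiv ℝ f) (C := L) (fun x hx => (hf x (hseg hx)).hasFDerivAt.hasFDerivWithinAt)
      (fun x hx => hL x (hseg hx)) (left_mem_segment ℝ z w) (right_mem_segment ℝ z w)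
    rw [Real.norm_eq_abs, norm_sub_rev w] at h1
    have h2 : L * ‖z - w‖ ≤ L * (2 * s) := by gcongr
    linarith
  · by_cases hor : z ∈ Ω ∨ w ∈ Ω
    · obtain ⟨x, hx, hxΩ⟩ := not_subset.1 hseg
      have hne : (segment ℝ z w ∩ Ω).Nonempty := by
        rcases hor with h | h
        · exact ⟨z, left_mem_segment ℝ z w, h⟩
        · exact ⟨w, right_mem_segment ℝ z w, h⟩
      obtain ⟨q, hq, hqf⟩ := inter_frontier_nonempty_of_isPreconnected hΩ
        (convex_segment z w).isPreconnected hne ⟨x, hx, hxΩ⟩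
      have hzL : z ∈ ⋃ q ∈ frontier Ω, Metric.closedBall q (2 * s) := by
        refine mem_iUnion₂.2 ⟨q, hqf, ?_⟩
        rw [Metric.mem_closedBall, dist_comm]
        refine le_trans ?_ hzw
        rw [← dist_eq_norm]
        have := dist_add_dist_of_mem_segment hq
        have h1 := dist_nonneg (x := q) (y := w)
        rw [dist_comm q z]
        linarith
      have hb : ∀ x, |Ω.indicator f x| ≤ B := by
        intro x
        by_cases hx : x ∈ Ω
        · rw [indicator_of_mem hx]; exact hB x hx
        · rw [indicator_of_notMem hx, abs_zero]; exact hB0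
      rw [indicator_of_mem hzL]
      have h1 := abs_sub (Ω.indicator f w) (Ω.indicator f z)
      linarith [hb w, hb z]
    · push Not at hor
      rw [indicator_of_notMem hor.1, indicator_of_notMem hor.2, sub_zero, abs_zero]
      have h3 := hn1
      rw [indicator_of_notMem hor.1] at h3 ⊢
      linarith

/-- The quadrature error of a Cartesian grid is of first order in the mesh size. -/
theorem IsLipschitzDomain.exists_quadrature_error_le (hΩ : IsLipschitzDomain Ω) {S : ℝ}
    (hS : 0 ≤ S) : ∃ C : ℝ, 0 ≤ C ∧ ∀ (s : ℝ) (M : ℕ) (y : Fin M → Plane), 0 < s → s ≤ S →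
      IsCartesianSample Ω s y → ∀ (f : Plane → ℝ) (B L : ℝ), 0 ≤ B → 0 ≤ L →
      (∀ z ∈ Ω, DifferentiableAt ℝ f z) → (∀ z ∈ Ω, |f z| ≤ B) →
      (∀ z ∈ Ω, ‖fderiv ℝ f z‖ ≤ L) →
      |s ^ 2 * ∑ k, f (y k) - ∫ z in Ω, f z| ≤ s * (2 * volume.real Ω * L + C * B) := by
  obtain ⟨C, hC, hlayer⟩ := hΩ.exists_volume_layer_le (S := 2 * S) (by positivity)
  -- One factor `2` is the layer width `2 s`, the other the jump `2 B`.
  refine ⟨4 * C, by positivity, fun s M y hs hsS ⟨hy, a, hr⟩ f B L hB0 hL0 hf hB hL => ?_⟩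
  set A : Set Plane := ⋃ q ∈ frontier Ω, Metric.closedBall q (2 * s) with hA
  have hAle := hlayer (2 * s) (by positivity) (by linarith)
  have hAm : MeasurableSet A := by
    rw [hA, ← hΩ.isCompact_frontier.cthickening_eq_biUnion_closedBall (by positivity)]
    exact Metric.isClosed_cthickening.measurableSet
  have hΩm := hΩ.isOpen.measurableSet
  have hΩfin : volume Ω ≠ ∞ := hΩ.bounded.measure_lt_top.ne
  have hAfin : volume A ≠ ∞ := (hAle.trans_lt ENNReal.ofReal_lt_top).ne
  have hfi : Integrable (Ω.indicator f) := by
    rw [integrable_indicator_iff hΩm]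
    refine IntegrableOn.of_bound hΩ.bounded.measure_lt_top ?_ B ?_
    · exact ContinuousOn.aestronglyMeasurable
        (fun z hz => (hf z hz).continuousAt.continuousWithinAt) hΩm
    · rw [ae_restrict_iff' hΩm]
      exact Eventually.of_forall fun z hz => hB z hz
  have hci : ∀ k, Integrable ((gridCell s (y k)).indicator fun _ => f (y k)) := fun k =>
    (integrable_indicator_iff (measurableSet_gridCell s (y k))).2
      (integrableOn_const (by rw [volume_gridCell hs]; exact ENNReal.ofReal_ne_top))
  have heq := indicator_gridFloor_eq_sum hs hy hr f
  have hsum : s ^ 2 * ∑ k, f (y k) = ∫ z, Ω.indicator f (gridFloor a s z) := by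
    simp_rw [heq]
    rw [integral_finsetSum _ fun k _ => hci k, Finset.mul_sum]
    refine Finset.sum_congr rfl fun k _ => ?_
    rw [integral_indicator (measurableSet_gridCell s (y k)), setIntegral_const, Measure.real,
      volume_gridCell hs, ENNReal.toReal_ofReal (by positivity), smul_eq_mul]
  have hgi : Integrable fun z => Ω.indicator f (gridFloor a s z) := by
    simp_rw [heq]
    exact integrable_finsetSum _ fun k _ => hci k
  have hi1 : Integrable (Ω.indicator fun _ => L * (2 * s)) :=
    (integrable_indicator_iff hΩm).2 (integrableOn_const hΩfin)
  have hi2 : Integrable (A.indicator fun _ => 2 * B) :=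
    (integrable_indicator_iff hAm).2 (integrableOn_const hAfin)
  have hAreal : volume.real A ≤ C * (2 * s) :=
    ENNReal.toReal_le_of_le_ofReal (by positivity) hAle
  rw [hsum, ← integral_indicator hΩm, ← integral_sub hgi hfi]
  calc |∫ z, (Ω.indicator f (gridFloor a s z) - Ω.indicator f z)|
      ≤ ∫ z, (Ω.indicator (fun _ => L * (2 * s)) z + A.indicator (fun _ => 2 * B) z) := by
        rw [← Real.norm_eq_abs]
        refine norm_integral_le_of_norm_le (hi1.add hi2) (Eventually.of_forall fun z => ?_)
        exact abs_indicator_gridFloor_sub_le hΩ.isOpen hs a hf hB hL hB0 hL0 z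
    _ = volume.real Ω * (L * (2 * s)) + volume.real A * (2 * B) := by
        rw [integral_add hi1 hi2, integral_indicator hΩm, integral_indicator hAm,
          setIntegral_const, setIntegral_const, smul_eq_mul, smul_eq_mul]
    _ ≤ volume.real Ω * (L * (2 * s)) + C * (2 * s) * (2 * B) := by gcongr
    _ = s * (2 * volume.real Ω * L + 4 * C * B) := by ring

end Quadrature

/-! ### The stability estimate -/

section Stability

variable {N M : ℕ} {Ω U : Set Plane} {X : Fin N → Plane} {Ψ : Fin N → Plane → ℝ}

theorem evalMatrix_mulVec (Ψ : Fin N → Plane → ℝ) (hy : ℝ) (y : Fin M → Plane) (v : Fin N → ℝ)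
    (k : Fin M) : (evalMatrix Ψ hy y *ᵥ v) k = hy * ansatz Ψ v (y k) := by
  simp only [evalMatrix, Matrix.mulVec, dotProduct, Matrix.smul_apply, Matrix.of_apply, smul_eq_mul,
    ansatz, Finset.mul_sum]
  exact Finset.sum_congr rfl fun i _ => by ring

theorem advectionMatrix_mulVec (hU : IsOpen U) (hΨ : ∀ i, ContDiffOn ℝ 2 (Ψ i) U)
    (W : Plane → Plane) (hy : ℝ) {y : Fin M → Plane} (hyU : ∀ k, y k ∈ U) (v : Fin N → ℝ)
    (k : Fin M) : (advectionMatrix Ψ W hy y *ᵥ v) k =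
      -(hy * fderiv ℝ (ansatz Ψ v) (y k) (W (y k))) := by
  rw [fderiv_ansatz hU hΨ v (hyU k)]
  simp only [advectionMatrix, Matrix.mulVec, dotProduct, Matrix.smul_apply, Matrix.of_apply,
    smul_eq_mul, FunLike.coe_sum, Finset.sum_apply, FunLike.coe_smul, Pi.smul_apply,
    Finset.mul_sum, ← Finset.sum_neg_distrib]
  exact Finset.sum_congr rfl fun i _ => by ring

theorem hasDerivWithinAt_discreteNormSq (hy : ℝ) (y : Fin M → Plane) {v : ℝ → Fin N → ℝ}
    {v' : Fin N → ℝ} {s : Set ℝ} {t : ℝ} (hv : HasDerivWithinAt v v' s t) :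
    HasDerivWithinAt (fun τ => discreteNormSq hy y (ansatz Ψ (v τ)))
      (hy ^ 2 * ∑ k, 2 * ansatz Ψ (v t) (y k) * ansatz Ψ v' (y k)) s t := by
  have h1 : ∀ z, HasDerivWithinAt (fun τ => ansatz Ψ (v τ) z) (ansatz Ψ v' z) s t := fun z =>
    HasDerivWithinAt.fun_sum fun i _ => ((hasDerivWithinAt_pi.1 hv) i).mul_const (Ψ i z)
  unfold discreteNormSq
  refine HasDerivWithinAt.const_mul _ (HasDerivWithinAt.fun_sum fun k _ => ?_)
  simpa using (h1 (y k)).fun_pow 2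

/-- The energy identity of the least-squares projected system. -/
theorem IsSemidiscreteSolution.hasDerivWithinAt (hU : IsOpen U)
    (hΨ : ∀ i, ContDiffOn ℝ 2 (Ψ i) U) {V : ℝ → Plane → Plane} {T hy : ℝ} {y : Fin M → Plane}
    {v : ℝ → Fin N → ℝ} (h : IsSemidiscreteSolution Ψ V T hy y v) (hyU : ∀ k, y k ∈ U) {t : ℝ}
    (ht : t ∈ Icc 0 T) :
    HasDerivWithinAt (fun τ => discreteNormSq hy y (ansatz Ψ (v τ)))
      (-(2 * (hy ^ 2 * ∑ k, ansatz Ψ (v t) (y k) *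
        fderiv ℝ (ansatz Ψ (v t)) (y k) (V t (y k))))) (Icc 0 T) t := by
  obtain ⟨v', hv', heq⟩ := h t ht
  convert hasDerivWithinAt_discreteNormSq (Ψ := Ψ) hy y hv' using 1
  -- Pairing the system with `v t` moves `Eᵀ` to the other side, so invertibility of `Eᵀ E` plays no
  -- role.
  have hadj : ∀ (B : Matrix (Fin M) (Fin N) ℝ) (w : Fin N → ℝ),
      v t ⬝ᵥ (((evalMatrix Ψ hy y)ᵀ * B) *ᵥ w) = (evalMatrix Ψ hy y *ᵥ v t) ⬝ᵥ (B *ᵥ w) := by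
    intro B w
    rw [← Matrix.mulVec_mulVec, Matrix.dotProduct_mulVec, Matrix.vecMul_transpose]
  have h1 := congrArg (fun w => v t ⬝ᵥ w) heq
  simp only [hadj] at h1
  simp only [dotProduct, evalMatrix_mulVec, advectionMatrix_mulVec hU hΨ _ hy hyU] at h1
  have h2 : hy ^ 2 * ∑ k, 2 * ansatz Ψ (v t) (y k) * ansatz Ψ v' (y k) =
      2 * ∑ k, hy * ansatz Ψ (v t) (y k) * (hy * ansatz Ψ v' (y k)) := by
    rw [Finset.mul_sum, Finset.mul_sum]
    exact Finset.sum_congr rfl fun k _ => by ring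
  rw [h2, h1, Finset.mul_sum, Finset.mul_sum, Finset.mul_sum, ← Finset.sum_neg_distrib]
  exact Finset.sum_congr rfl fun k _ => by ring

theorem bddAbove_range_fin {f : Fin N → ℝ} : BddAbove (range f) := (finite_range f).bddAbove

theorem integrandMax_nonneg (W : Plane → Plane) (u : Plane → ℝ) :
    0 ≤ integrandMax Ω X W u := Real.iSup_nonneg fun _ => supNorm_nonneg _ _

theorem velocityEnergyMax_nonneg (W : Plane → Plane) (u : Plane → ℝ) :
    0 ≤ velocityEnergyMax Ω X W u :=
  Real.iSup_nonneg fun _ => mul_nonneg (supNorm_nonneg _ _) (sq_nonneg _)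

/-- The inverse inequality in the trial space controls the advective term. -/
theorem integrandMax_le (hΩ : IsLipschitzDomain Ω) (hU : IsOpen U) (hΩU : closure Ω ⊆ U)
    (hΨ : ∀ i, ContDiffOn ℝ 2 (Ψ i) U) {κ : ℝ} (hκ : InverseInequality Ω X (trialSpace Ψ) κ)
    {W : Plane → Plane} (hW : Continuous W) (v : Fin N → ℝ) :
    integrandMax Ω X W (ansatz Ψ v) ≤
      κ * (nodeSpacing Ω N)⁻¹ * velocityEnergyMax Ω X W (ansatz Ψ v) := by
  have hcpt := hΩ.bounded.isCompact_closure
  have hu := contDiffOn_ansatz hΨ v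
  have hc : 0 ≤ κ * (nodeSpacing Ω N)⁻¹ := mul_nonneg hκ.1 (inv_nonneg.2 (Real.sqrt_nonneg _))
  refine Real.iSup_le (fun i => ?_) (mul_nonneg hc (velocityEnergyMax_nonneg _ _))
  set u := ansatz Ψ v with hudef
  set K := voronoiCell Ω X i with hK
  have hKc : K ⊆ closure Ω := (voronoiCell_subset Ω X i).trans subset_closure
  have h1 : supNorm K (fun z => u z * fderiv ℝ u z (W z)) ≤
      supNorm K u * (supNorm K (fderiv ℝ u) * supNorm K W) := by
    refine supNorm_le (mul_nonneg (supNorm_nonneg _ _)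
      (mul_nonneg (supNorm_nonneg _ _) (supNorm_nonneg _ _))) fun z hz => ?_
    rw [norm_mul]
    have hu1 := norm_le_supNorm hcpt hKc (hu.continuousOn.mono hΩU) hz
    have hu2 := norm_le_supNorm hcpt hKc
      ((hu.continuousOn_fderiv_of_isOpen hU (by norm_num)).mono hΩU) hz
    have hu3 := norm_le_supNorm hcpt hKc hW.continuousOn hz
    refine mul_le_mul hu1 ?_ (norm_nonneg _) (supNorm_nonneg _ _)
    exact ((fderiv ℝ u z).le_opNorm _).trans
      (mul_le_mul hu2 hu3 (norm_nonneg _) (supNorm_nonneg _ _))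
  have h2 : supNorm K W * supNorm K u ^ 2 ≤ velocityEnergyMax Ω X W u :=
    le_ciSup (f := fun i => supNorm (voronoiCell Ω X i) W * supNorm (voronoiCell Ω X i) u ^ 2)
      bddAbove_range_fin i
  calc supNorm K (fun z => u z * fderiv ℝ u z (W z))
      ≤ supNorm K u * (supNorm K (fderiv ℝ u) * supNorm K W) := h1
    _ ≤ supNorm K u * ((κ * (nodeSpacing Ω N)⁻¹ * supNorm K u) * supNorm K W) :=
        mul_le_mul_of_nonneg_left (mul_le_mul_of_nonneg_right (hκ.2 u ⟨v, rfl⟩ i)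
          (supNorm_nonneg _ _)) (supNorm_nonneg _ _)
    _ = κ * (nodeSpacing Ω N)⁻¹ * (supNorm K W * supNorm K u ^ 2) := by ring
    _ ≤ _ := mul_le_mul_of_nonneg_left h2 hc

theorem nodeSpacing_le (hN : 0 < N) (Ω : Set Plane) : nodeSpacing Ω N ≤ √(volume.real Ω) :=
  Real.sqrt_le_sqrt (div_le_self measureReal_nonneg (by exact_mod_cast hN))

/-- For `N = 0` the division by zero gives node spacing `0`, which excludes a positive mesh size
below it. -/
theorem pos_of_le_nodeSpacing {hy : ℝ} (h0 : 0 < hy) (h : hy ≤ nodeSpacing Ω N) : 0 < N := by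
  rcases Nat.eq_zero_or_pos N with rfl | hN
  · simp [nodeSpacing] at h
    linarith
  · exact hN

/-- The quadrature error for the advective term, with a constant depending only on `Ω`. -/
theorem IsLipschitzDomain.exists_integrationConst (hΩ : IsLipschitzDomain Ω) :
    ∃ c : ℝ, 0 < c ∧ ∀ (N : ℕ) (X : Fin N → Plane) (Ψ : Fin N → Plane → ℝ) (U : Set Plane)
      (W : Plane → Plane), IsOpen U → closure Ω ⊆ U → (∀ i, ContDiffOn ℝ 2 (Ψ i) U) →
      ContDiff ℝ 1 W → InverseInequality Ω X (advectionIntegrands Ψ W)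
        (inverseConst Ω X (advectionIntegrands Ψ W)) →
      ∀ (hy : ℝ) (M : ℕ) (y : Fin M → Plane) (v : Fin N → ℝ), 0 < hy → hy ≤ nodeSpacing Ω N →
        IsCartesianSample Ω hy y →
        |hy ^ 2 * ∑ k, ansatz Ψ v (y k) * fderiv ℝ (ansatz Ψ v) (y k) (W (y k)) -
          ∫ z in Ω, ansatz Ψ v z * fderiv ℝ (ansatz Ψ v) z (W z)| ≤
        integrationConst c Ω X Ψ W * (nodeSpacing Ω N)⁻¹ * hy *
          integrandMax Ω X W (ansatz Ψ v) := by
  obtain ⟨C, hC, hq⟩ := hΩ.exists_quadrature_error_le (Real.sqrt_nonneg (volume.real Ω))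
  have hvol : 0 ≤ volume.real Ω := measureReal_nonneg
  -- As `h ≤ √|Ω|`, the boundary layer term `C B` is at most `C √|Ω| h⁻¹ B`, which puts it on the
  -- same scale as the gradient term; the `1` makes positivity immediate.
  refine ⟨2 * volume.real Ω + C * √(volume.real Ω) + 1, by positivity, ?_⟩
  intro N X Ψ U W hU hΩU hΨ hW hκ hy M y v hy0 hyh hsample
  have hN := pos_of_le_nodeSpacing hy0 hyh
  have hh := nodeSpacing_pos (N := N) hΩ hN
  have hhle := nodeSpacing_le hN Ω
  set κ := inverseConst Ω X (advectionIntegrands Ψ W) with hκdef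
  set h := nodeSpacing Ω N with hhdef
  set u := ansatz Ψ v with hu
  set f : Plane → ℝ := fun z => u z * fderiv ℝ u z (W z) with hf
  set B := integrandMax Ω X W u with hB
  have hB0 : 0 ≤ B := integrandMax_nonneg W u
  have hfS : f ∈ advectionIntegrands Ψ W := ⟨u, ⟨v, rfl⟩, rfl⟩
  have hcpt := hΩ.bounded.isCompact_closure
  have huC := contDiffOn_ansatz hΨ v
  have hfC : ContDiffOn ℝ 1 f U := contDiffOn_mul_fderiv_apply hU huC huC hW
  have hKc : ∀ i, voronoiCell Ω X i ⊆ closure Ω := fun i =>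
    (voronoiCell_subset Ω X i).trans subset_closure
  have hsup : ∀ i, supNorm (voronoiCell Ω X i) f ≤ B := fun i =>
    le_ciSup (f := fun i => supNorm (voronoiCell Ω X i) f) bddAbove_range_fin i
  have hκh : 0 ≤ κ * h⁻¹ := mul_nonneg hκ.1 (inv_nonneg.2 hh.le)
  have hmain := hq hy M y hy0 (hyh.trans hhle) hsample f B (κ * h⁻¹ * B) hB0
    (mul_nonneg hκh hB0)
    (fun z hz => (hfC.contDiffAt (hU.mem_nhds (hΩU (subset_closure hz)))).differentiableAt
      (by simp))
    (fun z hz => by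
      obtain ⟨i, hi⟩ := exists_mem_voronoiCell (X := X) hN hz
      exact (norm_le_supNorm hcpt (hKc i) (hfC.continuousOn.mono hΩU) hi).trans (hsup i))
    (fun z hz => by
      obtain ⟨i, hi⟩ := exists_mem_voronoiCell (X := X) hN hz
      exact (norm_le_supNorm hcpt (hKc i)
        ((hfC.continuousOn_fderiv_of_isOpen hU le_rfl).mono hΩU) hi).trans
        ((hκ.2 f hfS i).trans (mul_le_mul_of_nonneg_left (hsup i) hκh)))
  refine hmain.trans ?_
  have h1 : C * B ≤ C * √(volume.real Ω) * h⁻¹ * B := by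
    have h2 : 1 ≤ √(volume.real Ω) * h⁻¹ := by
      rw [← div_eq_mul_inv, one_le_div hh]; exact hhle
    calc C * B = C * 1 * B := by ring
      _ ≤ C * (√(volume.real Ω) * h⁻¹) * B := by gcongr
      _ = _ := by ring
  have hS0 := Real.sqrt_nonneg (volume.real Ω)
  have hi0 : 0 ≤ h⁻¹ := inv_nonneg.2 hh.le
  have hκ0 : 0 ≤ κ := hκ.1
  have hrest : 0 ≤ (2 * volume.real Ω + (C * √(volume.real Ω) + 1) * κ + 1) * h⁻¹ * hy * B := by
    positivity
  calc hy * (2 * volume.real Ω * (κ * h⁻¹ * B) + C * B)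
      ≤ hy * (2 * volume.real Ω * (κ * h⁻¹ * B) + C * √(volume.real Ω) * h⁻¹ * B) := by gcongr
    _ ≤ hy * (2 * volume.real Ω * (κ * h⁻¹ * B) + C * √(volume.real Ω) * h⁻¹ * B) +
        (2 * volume.real Ω + (C * √(volume.real Ω) + 1) * κ + 1) * h⁻¹ * hy * B := by linarith
    _ = integrationConst (2 * volume.real Ω + C * √(volume.real Ω) + 1) Ω X Ψ W * h⁻¹ * hy * B := by
        rw [integrationConst, ← hκdef]; ring

theorem integrationConst_nonneg {c : ℝ} (hc : 0 ≤ c) (W : Plane → Plane) :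
    0 ≤ integrationConst c Ω X Ψ W :=
  mul_nonneg hc (add_nonneg zero_le_one (inverseConst_nonneg _ _ _))

theorem stabilityConst_nonneg {c : ℝ} (hc : 0 ≤ c) (W : Plane → Plane) :
    0 ≤ stabilityConst c Ω X Ψ W :=
  mul_nonneg (mul_nonneg zero_le_two (integrationConst_nonneg hc W)) (inverseConst_nonneg _ _ _)

end Stability

theorem mainTheorem1 (Ω : Set Plane) (hΩ : IsLipschitzDomain Ω) :
    ∃ c : ℝ, 0 < c ∧
      ∀ (N : ℕ) (X : Fin N → Plane) (Ψ : Fin N → Plane → ℝ),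
        Function.Injective X → (∀ i, X i ∈ closure Ω) →
        (IsKansaBasis X Ψ ∨ IsPUMBasis Ω X Ψ) →
        -- the inverse inequality holds in the trial space, with its (finite) smallest constant
        InverseInequality Ω X (trialSpace Ψ) (inverseConst Ω X (trialSpace Ψ)) ∧
        -- the constants are bounded uniformly over all spatially constant velocity fields
        (∃ B : ℝ, ∀ b : Plane, integrationConst c Ω X Ψ (fun _ => b) ≤ B ∧
          stabilityConst c Ω X Ψ (fun _ => b) ≤ B) ∧
        ∀ (T : ℝ) (V : ℝ → Plane → Plane), 0 < T →
          (∀ t ∈ Icc 0 T, ContDiff ℝ 1 (V t) ∧ ∀ z ∈ Ω, divergence (V t) z = 0) →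
          -- the inverse inequality holds for the integrands `u (V t · ∇u)`
          (∀ t ∈ Icc 0 T, InverseInequality Ω X (advectionIntegrands Ψ (V t))
            (inverseConst Ω X (advectionIntegrands Ψ (V t)))) ∧
          -- the stability estimate
          (∀ (hy : ℝ) (M : ℕ) (y : Fin M → Plane) (v : ℝ → Fin N → ℝ),
            0 < hy → hy ≤ nodeSpacing Ω N → IsCartesianSample Ω hy y →
            IsSemidiscreteSolution Ψ V T hy y v →
            ∀ t ∈ Icc 0 T,
              DifferentiableWithinAt ℝ (fun s => discreteNormSq hy y (ansatz Ψ (v s)))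
                (Icc 0 T) t ∧
              derivWithin (fun s => discreteNormSq hy y (ansatz Ψ (v s))) (Icc 0 T) t ≤
                2 * integrationConst c Ω X Ψ (V t) * (nodeSpacing Ω N)⁻¹ * hy *
                    integrandMax Ω X (V t) (ansatz Ψ (v t)) +
                  2 * inflowTerm Ω (V t) (ansatz Ψ (v t)) ∧
              2 * integrationConst c Ω X Ψ (V t) * (nodeSpacing Ω N)⁻¹ * hy *
                    integrandMax Ω X (V t) (ansatz Ψ (v t)) +
                  2 * inflowTerm Ω (V t) (ansatz Ψ (v t)) ≤
                stabilityConst c Ω X Ψ (V t) * (nodeSpacing Ω N ^ 2)⁻¹ * hy *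
                    velocityEnergyMax Ω X (V t) (ansatz Ψ (v t)) +
                  2 * inflowTerm Ω (V t) (ansatz Ψ (v t))) ∧
          -- for a fixed node set the spurious term vanishes as `hy → 0`
          (∀ t ∈ Icc 0 T, ∀ ε > 0, ∃ δ > 0,
            ∀ (hy : ℝ) (M : ℕ) (y : Fin M → Plane) (v : ℝ → Fin N → ℝ),
              0 < hy → hy ≤ nodeSpacing Ω N → hy < δ → IsCartesianSample Ω hy y →
              IsSemidiscreteSolution Ψ V T hy y v →
              derivWithin (fun s => discreteNormSq hy y (ansatz Ψ (v s))) (Icc 0 T) t ≤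
                ε * velocityEnergyMax Ω X (V t) (ansatz Ψ (v t)) +
                  2 * inflowTerm Ω (V t) (ansatz Ψ (v t))) := by
  obtain ⟨c, hc, hquad⟩ := hΩ.exists_integrationConst
  refine ⟨c, hc, fun N X Ψ hX _ hbasis => ?_⟩
  obtain ⟨U, hU, hΩU, hΨ⟩ := exists_contDiffOn_cardinal hbasis
  obtain ⟨κ₁, hκ₁⟩ := exists_inverseInequality_trialSpace hΩ hX hU hΩU hΨ
  have hI := hκ₁.inverseConst
  have hIf : ∀ W : Plane → Plane, ContDiff ℝ 1 W →
      InverseInequality Ω X (advectionIntegrands Ψ W)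
        (inverseConst Ω X (advectionIntegrands Ψ W)) := fun W hW =>
    (exists_inverseInequality_advection hΩ hX hU hΩU hΨ hW).choose_spec.inverseConst
  refine ⟨hI, ?_, fun T V hT hV => ?_⟩
  · obtain ⟨κ, hκ⟩ := exists_inverseInequality_advection_const hΩ hX hU hΩU hΨ
    refine ⟨max (c * (1 + κ)) (2 * (c * (1 + κ)) * inverseConst Ω X (trialSpace Ψ)), fun b => ?_⟩
    have h1 : integrationConst c Ω X Ψ (fun _ => b) ≤ c * (1 + κ) :=
      mul_le_mul_of_nonneg_left (by linarith [(hκ b).inverseConst_le]) hc.le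
    refine ⟨h1.trans (le_max_left _ _), le_trans ?_ (le_max_right _ _)⟩
    exact mul_le_mul_of_nonneg_right (by linarith) hI.1
  -- Shared by the second inequality of the estimate and by the limit of small mesh size.
  have hsecond : ∀ t ∈ Icc 0 T, ∀ (hy : ℝ) (w : Fin N → ℝ), 0 < hy →
      2 * integrationConst c Ω X Ψ (V t) * (nodeSpacing Ω N)⁻¹ * hy *
          integrandMax Ω X (V t) (ansatz Ψ w) ≤
        stabilityConst c Ω X Ψ (V t) * (nodeSpacing Ω N ^ 2)⁻¹ * hy *
          velocityEnergyMax Ω X (V t) (ansatz Ψ w) := by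
    intro t ht hy w hy0
    have h1 := integrandMax_le hΩ hU hΩU hΨ hI (hV t ht).1.continuous w
    have h2 : 0 ≤ 2 * integrationConst c Ω X Ψ (V t) * (nodeSpacing Ω N)⁻¹ * hy :=
      mul_nonneg (mul_nonneg (mul_nonneg zero_le_two (integrationConst_nonneg hc.le _))
        (inv_nonneg.2 (Real.sqrt_nonneg _))) hy0.le
    refine (mul_le_mul_of_nonneg_left h1 h2).trans (le_of_eq ?_)
    rw [stabilityConst, ← inv_pow]
    ring
  have hfirst : ∀ (hy : ℝ) (M : ℕ) (y : Fin M → Plane) (v : ℝ → Fin N → ℝ),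
      0 < hy → hy ≤ nodeSpacing Ω N → IsCartesianSample Ω hy y →
      IsSemidiscreteSolution Ψ V T hy y v → ∀ t ∈ Icc 0 T,
        DifferentiableWithinAt ℝ (fun s => discreteNormSq hy y (ansatz Ψ (v s))) (Icc 0 T) t ∧
        derivWithin (fun s => discreteNormSq hy y (ansatz Ψ (v s))) (Icc 0 T) t ≤
          2 * integrationConst c Ω X Ψ (V t) * (nodeSpacing Ω N)⁻¹ * hy *
              integrandMax Ω X (V t) (ansatz Ψ (v t)) +
            2 * inflowTerm Ω (V t) (ansatz Ψ (v t)) := by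
    intro hy M y v hy0 hyh hsample hsol t ht
    have hyU : ∀ k, y k ∈ U := by
      intro k
      obtain ⟨-, a, hr⟩ := hsample
      have h1 : y k ∈ range y := mem_range_self k
      rw [hr] at h1
      exact hΩU (subset_closure h1.1)
    have hder := hsol.hasDerivWithinAt hU hΨ hyU ht
    refine ⟨hder.differentiableWithinAt, ?_⟩
    rw [hder.derivWithin (uniqueDiffOn_Icc hT t ht)]
    have hq := hquad N X Ψ U (V t) hU hΩU hΨ (hV t ht).1 (hIf _ (hV t ht).1) hy M y (v t) hy0 hyh
      hsample
    have hdiv := hΩ.neg_two_integral_advection_le (hV t ht).1 (hV t ht).2 hU hΩU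
      ((contDiffOn_ansatz hΨ (v t)).of_le (by norm_num))
    -- The divergence theorem yields the inflow term with factor `1`; nonnegativity gives the stated
    -- factor `2`.
    have hin := inflowTerm_nonneg Ω (V t) (ansatz Ψ (v t))
    have hq1 := neg_le_of_abs_le hq
    linarith
  refine ⟨fun t ht => hIf _ (hV t ht).1, fun hy M y v hy0 hyh hsample hsol t ht => ?_,
    fun t ht ε hε => ?_⟩
  · obtain ⟨h1, h2⟩ := hfirst hy M y v hy0 hyh hsample hsol t ht
    exact ⟨h1, h2, by linarith [hsecond t ht hy (v t) hy0]⟩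
  · set A := stabilityConst c Ω X Ψ (V t) * (nodeSpacing Ω N ^ 2)⁻¹ with hA
    have hA0 : 0 ≤ A :=
      mul_nonneg (stabilityConst_nonneg hc.le _) (inv_nonneg.2 (sq_nonneg _))
    -- Since `A = C h⁻²` does not involve the grid, this gives `A hy ≤ ε`; the `+ 1` covers `A = 0`.
    refine ⟨ε / (A + 1), by positivity, fun hy M y v hy0 hyh hyδ hsample hsol => ?_⟩
    have h1 := (hfirst hy M y v hy0 hyh hsample hsol t ht).2
    have h2 := hsecond t ht hy (v t) hy0
    have h3 : A * hy ≤ ε := by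
      rw [lt_div_iff₀ (by positivity)] at hyδ
      nlinarith
    have h4 := mul_le_mul_of_nonneg_right h3
      (velocityEnergyMax_nonneg (Ω := Ω) (X := X) (V t) (ansatz Ψ (v t)))
    linarith
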